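/- All manifolds are smooth, real, finite-dimensional, without boundary, Hausdorff and second countable. Let $\epsilon:P\to Q$ be a surjective smooth submersion (for instance a smooth fiber bundle) and let $T_PQ=TQ\times_QP=\{(v_q,p): v_q\in T_qQ,\ \epsilon(p)=q\}$ and $T_P^*Q=T^*Q\times_QP$. A magnetic Lagrangian system $(\epsilon:P\to Q,L,\mathcal B)$ consists of such an $\epsilon$, a smooth function $L:T_PQ\to\mathbb R$ and a smooth closed 2-form $\mathcal B$ on $P$. Its fiber derivative is $\mathbb FL:T_PQ\to T_P^*Q$, $(v_q,p)\mapsto(\alpha_q,p)$ with $\langle\alpha_q,w_q\rangle=\frac{d}{du}\big|_{u=0}L(v_q+uw_q,p)$; its energy is $E_L(v_q,p)=\langle\mathbb FL(v_q,p),(v_q,p)\rangle-L(v_q,p)$; and $\Omega^{L,\mathcal B}=\mathbb FL^*(\pi_1^*\omega_Q+\pi_2^*\mathcal B)$, where $\pi_1:T_P^*Q\to T^*Q$ and $\pi_2:T_P^*Q\to P$ are the projections and $\omega_Q=d\theta_Q$ (locally $dp_i\wedge dq^i$) is the canonical symplectic form of $T^*Q$. A smooth curve $p(t)$ in $P$,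 defined on an open interval $J\subseteq\mathbb R$, is a solution of the Euler-Lagrange (EL) equations if the curve $\gamma(t)=(\dot q(t),p(t))$ in $T_PQ$, where $q(t)=\epsilon(p(t))$, satisfies $i_{\dot\gamma(t)}\Omega^{L,\mathcal B}(\gamma(t))=-dE_L(\gamma(t))$ for all $t\in J$. Let $G$ be a Lie group acting smoothly, freely and properly on $P$, and let the orbit space $P/G$ carry its quotient manifold structure, i.e. the smooth structure for which $\pi:P\to P/G$, $p\mapsto[p]$, is a smooth submersion. Suppose that $(\epsilon:P\to Q,L,\mathcal B,G)$ is fiberwise reducible: $\epsilon(gp)=\epsilon(p)$ and $L(v_q,gp)=L(v_q,p)$ for all $g\in G$, and $\mathcal B$ is $G$-invariant with $i_{\xi_P}\mathcal B=0$ for all $\xi\in\mathfrak g$, where $\xi_P$ is the infinitesimal generator of the action. Then there is exactly one magnetic Lagrangian system $(\bar\epsilon:P/G\to Q,\bar L,\bar{\mathcal B})$, the reduced system, with $\bar\epsilon([p])=\epsilon(p)$, $\bar L(v_q,[p])=L(v_q,p)$ and $\pi^*\bar{\mathcal B}=\mathcal B$. With $\tau_G:T_PQ\to T_{P/G}Q$,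 $(v_q,p)\mapsto(v_q,[p])$, it satisfies $\tau_G^*\Omega^{\bar L,\bar{\mathcal B}}=\Omega^{L,\mathcal B}$ and $\tau_G^*E_{\bar L}=E_L$. Every solution of the EL equations of the reduced system is the projection of a solution of the EL equations of the original system: if $\bar p:J\to P/G$ is a solution of the EL equations of $(\bar\epsilon,\bar L,\bar{\mathcal B})$ on an open interval $J$, there is a solution $p:J\to P$ of the EL equations of $(\epsilon,L,\mathcal B)$, on the same interval, with $[p(t)]=\bar p(t)$ for all $t\in J$. -/

import Mathlib

open Bundle
open scoped Manifold ContDiff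

noncomputable section

/-! ### Differential forms on manifolds -/

section Forms

variable {E : Type*} [NormedAddCommGroup E] [NormedSpace ℝ E]
  {H : Type*} [TopologicalSpace H] (I : ModelWithCorners ℝ E H)
  (M : Type*) [TopologicalSpace M] [ChartedSpace H M]

/-- A (not necessarily smooth) differential form of degree `k` on `M`: an alternating `k`-linear
form on each tangent space. -/
abbrev DForm (k : ℕ) : Type _ := (x : M) → TangentSpace I x [⋀^Fin k]→L[ℝ] ℝ

variable {I M}

/-- The form `η` written in the preferred chart at `x`: its pullback by the inverse of the chart,
a form on an open subset of the model vector space `E`. -/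
def DForm.inChart {k : ℕ} (η : DForm I M k) (x : M) : E → E [⋀^Fin k]→L[ℝ] ℝ :=
  fun y => (η ((extChartAt I x).symm y)).compContinuousLinearMap
    (mfderiv 𝓘(ℝ, E) I (extChartAt I x).symm y)

/-- Smoothness of a form: it is smooth in every preferred chart (these charts cover `M`). -/
def DForm.IsSmooth {k : ℕ} (η : DForm I M k) : Prop :=
  ∀ x : M, ContDiffOn ℝ ∞ (η.inChart x) (extChartAt I x).target

/-- The exterior derivative on a manifold without boundary: at `x`, take the exterior derivative
of the expression of `η` in the chart at `x`, and pull it back by this chart. -/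
def DForm.d {k : ℕ} (η : DForm I M k) : DForm I M (k + 1) :=
  fun x => (extDeriv (η.inChart x) (extChartAt I x x)).compContinuousLinearMap
    (mfderiv I 𝓘(ℝ, E) (extChartAt I x) x)

/-- A form is closed if its exterior derivative vanishes. -/
def DForm.IsClosed {k : ℕ} (η : DForm I M k) : Prop := ∀ x : M, η.d x = 0

/-- The pullback of a form by a (differentiable) map. -/
def DForm.pullback {E' : Type*} [NormedAddCommGroup E'] [NormedSpace ℝ E']
    {H' : Type*} [TopologicalSpace H'] {I' : ModelWithCorners ℝ E' H'}
    {N : Type*} [TopologicalSpace N] [ChartedSpace H' N] {k : ℕ}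
    (f : M → N) (η : DForm I' N k) : DForm I M k :=
  fun x => (η (f x)).compContinuousLinearMap (mfderiv I I' f x)

/-- A smooth submersion between finite-dimensional manifolds. -/
def IsSmoothSubmersion {E' : Type*} [NormedAddCommGroup E'] [NormedSpace ℝ E']
    {H' : Type*} [TopologicalSpace H'] (I : ModelWithCorners ℝ E H)
    (I' : ModelWithCorners ℝ E' H')
    {N : Type*} [TopologicalSpace N] [ChartedSpace H' N] (f : M → N) : Prop :=
  ContMDiff I I' ∞ f ∧ ∀ x : M, Function.Surjective (mfderiv I I' f x)

end Forms

/-! ### The canonical symplectic form of a cotangent bundle -/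

section Cotangent

/-- The cotangent space `T*_q Q`. -/
abbrev CotangentSpace (EQ : Type*) [NormedAddCommGroup EQ] [NormedSpace ℝ EQ]
    {Q : Type*} [TopologicalSpace Q] [ChartedSpace EQ Q] (q : Q) : Type _ :=
  TangentSpace 𝓘(ℝ, EQ) q →L[ℝ] Bundle.Trivial Q ℝ q

variable (EQ : Type*) [NormedAddCommGroup EQ] [NormedSpace ℝ EQ]
  (Q : Type*) [TopologicalSpace Q] [ChartedSpace EQ Q] [IsManifold 𝓘(ℝ, EQ) ∞ Q]

/-- The cotangent bundle `T*Q`. -/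
abbrev CotBundle : Type _ := TotalSpace (EQ →L[ℝ] ℝ) (fun q : Q => CotangentSpace EQ q)

/-- The canonical 1-form on `T*Q`: `θ_α (w) = ⟨α, Tπ (w)⟩`, with `π : T*Q → Q`. -/
def canonicalOneForm : DForm (𝓘(ℝ, EQ).prod 𝓘(ℝ, EQ →L[ℝ] ℝ)) (CotBundle EQ Q) 1 :=
  fun α => ContinuousAlternatingMap.ofSubsingleton ℝ _ ℝ (0 : Fin 1)
    (ContinuousLinearMap.comp (M₃ := ℝ) α.2
      (mfderiv (𝓘(ℝ, EQ).prod 𝓘(ℝ, EQ →L[ℝ] ℝ)) 𝓘(ℝ, EQ)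
        (fun β : CotBundle EQ Q => β.proj) α))

/-- The canonical symplectic form on `T*Q`, `ω_Q = dθ`; in coordinates `dp_i ∧ dq^i`. -/
def canonicalTwoForm : DForm (𝓘(ℝ, EQ).prod 𝓘(ℝ, EQ →L[ℝ] ℝ)) (CotBundle EQ Q) 2 :=
  (canonicalOneForm EQ Q).d

end Cotangent

/-! ### Magnetic Lagrangian systems -/

section Magnetic

variable {EP : Type*} [NormedAddCommGroup EP] [NormedSpace ℝ EP]
  {EQ : Type*} [NormedAddCommGroup EQ] [NormedSpace ℝ EQ]
  {P : Type*} [TopologicalSpace P] [ChartedSpace EP P] [IsManifold 𝓘(ℝ, EP) ∞ P]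
  {Q : Type*} [TopologicalSpace Q] [ChartedSpace EQ Q] [IsManifold 𝓘(ℝ, EQ) ∞ Q]

/-- The fiber product `T_P Q = TQ ×_Q P`, as the total space of the pullback of the tangent bundle
of `Q` by `ε : P → Q`; its points are written `⟨p, v⟩` with `v ∈ T_{ε(p)} Q`. -/
abbrev TPQ (ε : C^∞⟮𝓘(ℝ, EP), P; 𝓘(ℝ, EQ), Q⟯) : Type _ :=
  TotalSpace EQ (ε *ᵖ (fun q : Q => TangentSpace 𝓘(ℝ, EQ) q))

/-- The fiber product `T*_P Q = T*Q ×_Q P`. -/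
abbrev TstarPQ (ε : C^∞⟮𝓘(ℝ, EP), P; 𝓘(ℝ, EQ), Q⟯) : Type _ :=
  TotalSpace (EQ →L[ℝ] ℝ) (ε *ᵖ (fun q : Q => CotangentSpace EQ q))

/-- The projection `τ₁ : T_P Q → TQ`. -/
def TPQ.tau1 (ε : C^∞⟮𝓘(ℝ, EP), P; 𝓘(ℝ, EQ), Q⟯) (z : TPQ ε) :
    TangentBundle 𝓘(ℝ, EQ) Q :=
  ⟨ε z.proj, z.2⟩

/-- The point `(v_q, p)` of `T_P Q`, for `v_q ∈ T_q Q` and `p ∈ P` with `ε(p) = q`. -/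
def TPQ.mk (ε : C^∞⟮𝓘(ℝ, EP), P; 𝓘(ℝ, EQ), Q⟯) (v : TangentBundle 𝓘(ℝ, EQ) Q) (p : P)
    (h : v.proj = ε p) : TPQ ε :=
  ⟨p, (h ▸ v.2 : TangentSpace 𝓘(ℝ, EQ) (ε p))⟩

/-- The projection `π₁ : T*_P Q → T*Q`. -/
def TstarPQ.pi1 (ε : C^∞⟮𝓘(ℝ, EP), P; 𝓘(ℝ, EQ), Q⟯) (a : TstarPQ ε) : CotBundle EQ Q :=
  ⟨ε a.proj, a.2⟩

/-- The projection `π₂ : T*_P Q → P`. -/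
def TstarPQ.pi2 (ε : C^∞⟮𝓘(ℝ, EP), P; 𝓘(ℝ, EQ), Q⟯) (a : TstarPQ ε) : P := a.proj

variable (EP EQ P Q) in
/-- A magnetic Lagrangian system `(ε : P → Q, L, B)`. The map `ε` is a surjective submersion
(this includes all smooth fiber bundles), the Lagrangian `L` is a smooth function on `T_P Q` and
the magnetic form `B` is a smooth closed 2-form on `P`. -/
structure MagneticLagrangianSystem where
  ε : C^∞⟮𝓘(ℝ, EP), P; 𝓘(ℝ, EQ), Q⟯
  surjective : Function.Surjective ε
  submersion : IsSmoothSubmersion 𝓘(ℝ, EP) 𝓘(ℝ, EQ) ε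
  L : TPQ ε → ℝ
  smooth_L : ContMDiff (𝓘(ℝ, EP).prod 𝓘(ℝ, EQ)) 𝓘(ℝ, ℝ) ∞ L
  B : DForm 𝓘(ℝ, EP) P 2
  smooth_B : B.IsSmooth
  closed_B : B.IsClosed

namespace MagneticLagrangianSystem

variable (S : MagneticLagrangianSystem EP EQ P Q)

/-- The covector `α_q ∈ T*_q Q` with `⟨α_q, w⟩ = d/du|₀ L(v_q + u w, p)`. -/
def fiberCovector (z : TPQ S.ε) : CotangentSpace EQ (S.ε z.proj) :=
  fderiv ℝ (fun w : TangentSpace 𝓘(ℝ, EQ) (S.ε z.proj) => S.L ⟨z.proj, w⟩) z.2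

/-- The fiber derivative `FL : T_P Q → T*_P Q`. -/
def fiberDeriv (z : TPQ S.ε) : TstarPQ S.ε := ⟨z.proj, S.fiberCovector z⟩

/-- The energy `E_L (v_q, p) = ⟨FL (v_q, p), (v_q, p)⟩ - L (v_q, p)`. -/
def energy (z : TPQ S.ε) : ℝ := S.fiberCovector z z.2 - S.L z

/-- The closed 2-form `π₁^* ω_Q + π₂^* B` on `T*_P Q`. -/
def cotForm : DForm (𝓘(ℝ, EP).prod 𝓘(ℝ, EQ →L[ℝ] ℝ)) (TstarPQ S.ε) 2 :=
  fun a => DForm.pullback (TstarPQ.pi1 S.ε) (canonicalTwoForm EQ Q) a +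
    DForm.pullback (TstarPQ.pi2 S.ε) S.B a

/-- The 2-form `Ω^{L,B} = FL^* (π₁^* ω_Q + π₂^* B)` on `T_P Q`. -/
def Omega : DForm (𝓘(ℝ, EP).prod 𝓘(ℝ, EQ)) (TPQ S.ε) 2 :=
  DForm.pullback S.fiberDeriv S.cotForm

/-- The curve `γ(t) = (q'(t), p(t))` in `T_P Q` induced by a curve `p(t)` in `P`, where
`q(t) = ε(p(t))`. -/
def inducedCurve (p : ℝ → P) (t : ℝ) : TPQ S.ε :=
  ⟨p t, (mfderiv 𝓘(ℝ, ℝ) 𝓘(ℝ, EQ) (fun s => S.ε (p s)) t (1 : ℝ) :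
    TangentSpace 𝓘(ℝ, EQ) (S.ε (p t)))⟩

/-- A curve `p(t)`, smooth on the open interval `J`, is a solution of the Euler-Lagrange equations
on `J` iff `i_{γ'(t)} Ω^{L,B} (γ(t)) = - dE_L (γ(t))` for all `t ∈ J`. -/
def IsELSolution (J : Set ℝ) (p : ℝ → P) : Prop :=
  ContMDiffOn 𝓘(ℝ, ℝ) 𝓘(ℝ, EP) ∞ p J ∧
  ∀ t ∈ J, ∀ w : TangentSpace (𝓘(ℝ, EP).prod 𝓘(ℝ, EQ)) (S.inducedCurve p t),
    S.Omega (S.inducedCurve p t)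
        ![mfderiv 𝓘(ℝ, ℝ) (𝓘(ℝ, EP).prod 𝓘(ℝ, EQ)) (S.inducedCurve p) t (1 : ℝ), w] =
      - (mfderiv (𝓘(ℝ, EP).prod 𝓘(ℝ, EQ)) 𝓘(ℝ, ℝ) S.energy (S.inducedCurve p t) w : ℝ)

end MagneticLagrangianSystem

/-! ### Fiberwise reducible systems and their reduction -/

variable {EG : Type*} [NormedAddCommGroup EG] [NormedSpace ℝ EG]
  (G : Type*) [Group G] [TopologicalSpace G] [ChartedSpace EG G] [MulAction G P]

variable (P EG) in
/-- The infinitesimal generator `ξ_P (p) = d/ds|₀ (exp (s ξ) p)`, that is, the image of `ξ` under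
the derivative at `1` of the orbit map `g ↦ g p`. -/
def infinitesimalGenerator (ξ : GroupLieAlgebra 𝓘(ℝ, EG) G) (p : P) :
    TangentSpace 𝓘(ℝ, EP) p :=
  (one_smul G p) ▸ (mfderiv 𝓘(ℝ, EG) 𝓘(ℝ, EP) (fun g : G => g • p) 1 ξ :
    TangentSpace 𝓘(ℝ, EP) ((1 : G) • p))

namespace MagneticLagrangianSystem

variable (EG) in
/-- The system is fiberwise reducible for the action of `G` on `P`: the action is tangent to the
fibers of `ε`, the Lagrangian is invariant under the lifted action `g (v_q, p) = (v_q, g p)`, and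
the magnetic form is basic: it is `G`-invariant and `i_{ξ_P} B = 0` for all `ξ` in the Lie algebra. -/
structure FiberwiseReducible (S : MagneticLagrangianSystem EP EQ P Q) : Prop where
  tangent : ∀ (g : G) (p : P), S.ε (g • p) = S.ε p
  invariant_L : ∀ (g : G) (z : TPQ S.ε),
    S.L (TPQ.mk S.ε (TPQ.tau1 S.ε z) (g • z.proj) (tangent g z.proj).symm) = S.L z
  invariant_B : ∀ g : G, DForm.pullback (fun p : P => g • p) S.B = S.B
  horizontal_B : ∀ (ξ : GroupLieAlgebra 𝓘(ℝ, EG) G) (p : P) (w : TangentSpace 𝓘(ℝ, EP) p),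
    S.B p ![infinitesimalGenerator P EG G ξ p, w] = 0

end MagneticLagrangianSystem

variable (P) in
/-- The projection `P → P/G` onto the orbit space. -/
def orbitProj (p : P) : MulAction.orbitRel.Quotient G P := Quotient.mk _ p

variable {EB : Type*} [NormedAddCommGroup EB] [NormedSpace ℝ EB]
  [ChartedSpace EB (MulAction.orbitRel.Quotient G P)]
  [IsManifold 𝓘(ℝ, EB) ∞ (MulAction.orbitRel.Quotient G P)]

/-- The projection `τ_G : T_P Q → T_{P/G} Q`, `(v_q, p) ↦ (v_q, [p])`. -/
def tauG {ε : C^∞⟮𝓘(ℝ, EP), P; 𝓘(ℝ, EQ), Q⟯}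
    {ε' : C^∞⟮𝓘(ℝ, EB), MulAction.orbitRel.Quotient G P; 𝓘(ℝ, EQ), Q⟯}
    (h : ∀ p : P, ε' (orbitProj P G p) = ε p) (z : TPQ ε) : TPQ ε' :=
  TPQ.mk ε' (TPQ.tau1 ε z) (orbitProj P G z.proj) (h z.proj).symm

/-- `S'` is the reduced system `(P/G → Q, L', B')` associated with `S`: `ε'([p]) = ε(p)`,
`L'(v_q, [p]) = L(v_q, p)`, and the pullback of `B'` to `P` is `B`. -/
structure IsReducedSystem (S : MagneticLagrangianSystem EP EQ P Q)
    (S' : MagneticLagrangianSystem EB EQ (MulAction.orbitRel.Quotient G P) Q) : Prop where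
  eps : ∀ p : P, S'.ε (orbitProj P G p) = S.ε p
  lagrangian : ∀ z : TPQ S.ε, S'.L (tauG G eps z) = S.L z
  magnetic : DForm.pullback (orbitProj P G) S'.B = S.B

end Magnetic

end

noncomputable section

set_option linter.unusedSectionVars false

section LocalSections

open Filter Topology

/-- A smooth map between finite-dimensional vector spaces has smooth local sections near every
point at which its derivative is surjective. -/
theorem exists_contDiffAt_localSection
    {E : Type*} [NormedAddCommGroup E] [NormedSpace ℝ E]
    {F : Type*} [NormedAddCommGroup F] [NormedSpace ℝ F] [FiniteDimensional ℝ F]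
    {f : E → F} {a : E} (hf : ∀ᶠ x in 𝓝 a, ContDiffAt ℝ ∞ f x)
    (hsurj : Function.Surjective (fderiv ℝ f a)) :
    ∃ s : F → E, s (f a) = a ∧ ∀ᶠ y in 𝓝 (f a), f (s y) = y ∧ ContDiffAt ℝ ∞ s y := by
  obtain ⟨A, hA⟩ := (fderiv ℝ f a).toLinearMap.exists_rightInverse_of_surjective
    (LinearMap.range_eq_top.2 hsurj)
  set A' : F →L[ℝ] E := LinearMap.toContinuousLinearMap A with hA'
  have hAA : ∀ v, fderiv ℝ f a (A' v) = v := fun v => by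
    exact LinearMap.congr_fun hA v
  set k : F → E := fun y => a + A' (y - f a) with hk
  have hkc : ContDiff ℝ ∞ k := by fun_prop
  have hka : k (f a) = a := by simp [hk]
  have hkd : ∀ y, HasFDerivAt k A' y := fun y => by
    have := (A'.hasFDerivAt (x := y - f a)).comp y ((hasFDerivAt_id y).sub_const (f a))
    simpa [hk, Function.comp_def] using this.const_add a
  set h : F → F := f ∘ k with hh
  have hev : ∀ᶠ y in 𝓝 (f a), ContDiffAt ℝ ∞ h y := by
    have : Tendsto k (𝓝 (f a)) (𝓝 a) := by
      simpa [hka] using hkc.continuous.tendsto (f a)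
    filter_upwards [this.eventually hf] with y hy
    exact hy.comp y hkc.contDiffAt
  have hc : ContDiffAt ℝ ∞ h (f a) := hev.self_of_nhds
  have hd : HasFDerivAt h (ContinuousLinearEquiv.refl ℝ F : F →L[ℝ] F) (f a) := by
    have h1 : HasFDerivAt f (fderiv ℝ f a) (k (f a)) := by
      rw [hka]; exact (hf.self_of_nhds.differentiableAt (by simp)).hasFDerivAt
    convert h1.comp (f a) (hkd (f a)) using 1
    ext v; simp [hAA]
  set e := hc.toOpenPartialHomeomorph h hd (by simp) with he
  have hea : (f a) ∈ e.source := hc.mem_toOpenPartialHomeomorph_source hd (by simp)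
  have hcoe : (e : F → F) = h := rfl
  have hha : h (f a) = f a := by simp [hh, hka]
  have hta : f a ∈ e.target := by
    have := e.map_source hea
    rwa [hcoe, hha] at this
  have hsa : e.symm (f a) = f a := by
    have := e.left_inv hea
    rwa [hcoe, hha] at this
  have hdev : ∀ᶠ y in 𝓝 (f a), ∃ B : F ≃L[ℝ] F, HasFDerivAt h (B : F →L[ℝ] F) y := by
    have hcd : ContinuousAt (fderiv ℝ h) (f a) :=
      (hc.fderiv_right (m := 0) (by simp)).continuousAt
    have h2 : fderiv ℝ h (f a) = (ContinuousLinearEquiv.refl ℝ F : F →L[ℝ] F) := hd.fderiv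
    have h3 : ∀ᶠ y in 𝓝 (f a), fderiv ℝ h y ∈
        Set.range ((↑) : (F ≃L[ℝ] F) → F →L[ℝ] F) := by
      apply hcd.eventually
      rw [h2]; exact ContinuousLinearEquiv.nhds _
    filter_upwards [h3, hev] with y ⟨B, hB⟩ hy
    exact ⟨B, hB ▸ (hy.differentiableAt (by simp)).hasFDerivAt⟩
  have htend : Tendsto e.symm (𝓝 (f a)) (𝓝 (f a)) := by
    have := e.continuousAt_symm hta
    rwa [ContinuousAt, hsa] at this
  refine ⟨k ∘ e.symm, by simp [hsa, hka], ?_⟩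
  filter_upwards [htend.eventually hdev, htend.eventually hev, e.open_target.mem_nhds hta]
    with y ⟨B, hB⟩ hy hyt
  exact ⟨e.right_inv hyt, hkc.contDiffAt.comp y (e.contDiffAt_symm hyt hB hy)⟩

variable {E : Type*} [NormedAddCommGroup E] [NormedSpace ℝ E]
  {H : Type*} [TopologicalSpace H] {I : ModelWithCorners ℝ E H} [I.Boundaryless]
  {M : Type*} [TopologicalSpace M] [ChartedSpace H M] [IsManifold I ∞ M]

theorem contDiffAt_comp_extChartAt_symm
    {F : Type*} [NormedAddCommGroup F] [NormedSpace ℝ F] {n : ℕ∞}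
    {f : M → F} {x : M} {y : E} (hy : y ∈ (extChartAt I x).target)
    (hf : ContMDiffAt I 𝓘(ℝ, F) n f ((extChartAt I x).symm y)) :
    ContDiffAt ℝ n (f ∘ (extChartAt I x).symm) y := by
  rw [← contMDiffAt_iff_contDiffAt]
  have : ContMDiffAt 𝓘(ℝ, E) I ∞ (extChartAt I x).symm y :=
    (contMDiffOn_extChartAt_symm x).contMDiffAt (extChartAt_target_mem_nhds' hy)
  exact hf.comp y (this.of_le (by exact_mod_cast le_top))

/-- A smooth map between manifolds has smooth local sections near every point at which its
derivative is surjective. -/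
theorem exists_contMDiffAt_localSection
    {F : Type*} [NormedAddCommGroup F] [NormedSpace ℝ F] [FiniteDimensional ℝ F]
    {N : Type*} [TopologicalSpace N] [ChartedSpace F N] [IsManifold 𝓘(ℝ, F) ∞ N]
    {f : M → N} {x : M} (hf : ∀ᶠ z in 𝓝 x, ContMDiffAt I 𝓘(ℝ, F) ∞ f z)
    (hsurj : Function.Surjective (mfderiv I 𝓘(ℝ, F) f x)) :
    ∃ s : N → M, s (f x) = x ∧
      ∀ᶠ y in 𝓝 (f x), f (s y) = y ∧ ContMDiffAt 𝓘(ℝ, F) I ∞ s y := by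
  set φ := extChartAt I x
  set ψ := extChartAt 𝓘(ℝ, F) (f x)
  set a := φ x
  have hax : φ.symm a = x := extChartAt_to_inv (I := I) x
  have ht : φ.target ∈ 𝓝 a := extChartAt_target_mem_nhds x
  have hsymm : Tendsto φ.symm (𝓝 a) (𝓝 x) := by
    have := continuousAt_extChartAt_symm (I := I) x
    rwa [ContinuousAt, extChartAt_to_inv] at this
  have hsrc : ∀ᶠ z in 𝓝 x, f z ∈ ψ.source :=
    hf.self_of_nhds.continuousAt (extChartAt_source_mem_nhds (f x))
  have h1 : ∀ᶠ y in 𝓝 a, ContDiffAt ℝ ∞ (ψ ∘ f ∘ φ.symm) y := by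
    filter_upwards [ht, hsymm.eventually hf, hsymm.eventually hsrc] with y hy hfy hsy
    refine contDiffAt_comp_extChartAt_symm (f := ψ ∘ f) hy ?_
    exact (contMDiffAt_extChartAt' ((extChartAt_source 𝓘(ℝ, F) (f x)) ▸ hsy)).comp _ hfy
  have h2 : Function.Surjective (fderiv ℝ (ψ ∘ f ∘ φ.symm) a) := by
    have hd := hf.self_of_nhds.mdifferentiableAt (by simp)
    have he : fderivWithin ℝ (writtenInExtChartAt I 𝓘(ℝ, F) x f) (Set.range I) a =
        fderiv ℝ (ψ ∘ f ∘ φ.symm) a := by rw [I.range_eq_univ, fderivWithin_univ]; rfl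
    have he' := hd.mfderiv.trans he
    intro v
    obtain ⟨w, hw⟩ := hsurj v
    exact ⟨w, (DFunLike.congr_fun he' w).symm.trans hw⟩
  obtain ⟨s, hs, hs'⟩ := exists_contDiffAt_localSection h1 h2
  have hb : (ψ ∘ f ∘ φ.symm) a = ψ (f x) := by simp [hax]
  rw [hb] at hs hs'
  have hψ : Tendsto ψ (𝓝 (f x)) (𝓝 (ψ (f x))) := continuousAt_extChartAt (f x)
  have hsc : Tendsto s (𝓝 (ψ (f x))) (𝓝 a) := by
    have := hs'.self_of_nhds.2.continuousAt
    rwa [ContinuousAt, hs] at this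
  refine ⟨fun y => φ.symm (s (ψ y)), by simp [hs, hax], ?_⟩
  have h3 := hsc.comp hψ
  filter_upwards [hψ.eventually hs', h3.eventually ht, (hsymm.comp h3).eventually hsrc,
    extChartAt_source_mem_nhds (I := 𝓘(ℝ, F)) (f x)] with y hy hy2 hy3 hy4
  refine ⟨ψ.injOn hy3 hy4 hy.1, ?_⟩
  have h4 : ContMDiffAt 𝓘(ℝ, E) I ∞ φ.symm (s (ψ y)) :=
    (contMDiffOn_extChartAt_symm x).contMDiffAt (extChartAt_target_mem_nhds' hy2)
  exact h4.comp y ((contMDiffAt_iff_contDiffAt.2 hy.2).comp y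
    (contMDiffAt_extChartAt' ((extChartAt_source 𝓘(ℝ, F) (f x)) ▸ hy4)))

/-- The image of a set under a `C^1` map from a finite-dimensional manifold to a vector space has
Hausdorff dimension at most the dimension of the manifold. -/
theorem dimH_image_le_finrank_of_contMDiffAt [FiniteDimensional ℝ E] [SecondCountableTopology M]
    {F : Type*} [NormedAddCommGroup F] [NormedSpace ℝ F]
    {f : M → F} {W : Set M} (hf : ∀ x ∈ W, ContMDiffAt I 𝓘(ℝ, F) 1 f x) :
    dimH (f '' W) ≤ Module.finrank ℝ E := by
  have key : ∀ x ∈ W, ∃ V ∈ 𝓝[W] x, dimH (f '' V) ≤ Module.finrank ℝ E := by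
    intro x hx
    have hc : ContDiffAt ℝ 1 (f ∘ (extChartAt I x).symm) (extChartAt I x x) :=
      contDiffAt_comp_extChartAt_symm (n := 1) (mem_extChartAt_target x)
        (by simpa using hf x hx)
    obtain ⟨u, hu, hcu⟩ := hc.contDiffOn (m := 1) le_rfl (by simp)
    obtain ⟨r, hr, hru⟩ := Metric.mem_nhds_iff.1 (by simpa using hu)
    refine ⟨(extChartAt I x).source ∩ extChartAt I x ⁻¹' Metric.ball (extChartAt I x x) r,
      mem_nhdsWithin_of_mem_nhds (inter_mem (extChartAt_source_mem_nhds x)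
        ((continuousAt_extChartAt x) (Metric.ball_mem_nhds _ hr))), ?_⟩
    refine (dimH_mono (t := (f ∘ (extChartAt I x).symm) '' Metric.ball (extChartAt I x x) r)
      ?_).trans ?_
    · rintro _ ⟨z, ⟨hz, hz'⟩, rfl⟩
      exact ⟨_, hz', congrArg f ((extChartAt I x).left_inv hz)⟩
    · refine ((hcu.mono hru).dimH_image_le (convex_ball _ _) subset_rfl).trans ?_
      rw [← Real.dimH_univ_eq_finrank]
      exact dimH_mono (Set.subset_univ _)
  choose! V hV hd using key
  obtain ⟨t, htW, htc, ht⟩ := TopologicalSpace.countable_cover_nhdsWithin hV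
  calc dimH (f '' W) ≤ dimH (⋃ x ∈ t, f '' V x) := by
        refine dimH_mono ?_
        rw [← Set.image_iUnion₂]
        exact Set.image_mono ht
    _ ≤ Module.finrank ℝ E := by
        rw [dimH_bUnion htc]
        exact iSup₂_le fun x hx => hd x (htW hx)

end LocalSections

section ModelDeriv

open Filter Topology

variable {E : Type*} [NormedAddCommGroup E] [NormedSpace ℝ E]
  {H : Type*} [TopologicalSpace H] (I : ModelWithCorners ℝ E H)
  {M : Type*} [TopologicalSpace M] [ChartedSpace H M]
  {E' : Type*} [NormedAddCommGroup E'] [NormedSpace ℝ E']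
  {H' : Type*} [TopologicalSpace H'] (I' : ModelWithCorners ℝ E' H')
  {M' : Type*} [TopologicalSpace M'] [ChartedSpace H' M']
  {E'' : Type*} [NormedAddCommGroup E''] [NormedSpace ℝ E'']
  {H'' : Type*} [TopologicalSpace H''] (I'' : ModelWithCorners ℝ E'' H'')
  {M'' : Type*} [TopologicalSpace M''] [ChartedSpace H'' M'']

/-- The derivative of a map between manifolds, regarded as a linear map between the model
vector spaces. -/
def modelDeriv (f : M → M') (x : M) : E →L[ℝ] E' := mfderiv I I' f x

variable {I I' I''}

theorem modelDeriv_comp {f : M → M'} {g : M' → M''} (x : M) {y : M'}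
    (hg : MDifferentiableAt I' I'' g y) (hf : MDifferentiableAt I I' f x) (hy : f x = y) :
    modelDeriv I I'' (g ∘ f) x = (modelDeriv I' I'' g y).comp (modelDeriv I I' f x) :=
  by subst hy; exact mfderiv_comp x hg hf

theorem modelDeriv_comp_apply {f : M → M'} {g : M' → M''} (x : M) {y : M'}
    (hg : MDifferentiableAt I' I'' g y) (hf : MDifferentiableAt I I' f x) (hy : f x = y) (v : E) :
    modelDeriv I I'' (g ∘ f) x v = modelDeriv I' I'' g y (modelDeriv I I' f x v) := by
  rw [modelDeriv_comp x hg hf hy]; rfl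

theorem Filter.EventuallyEq.modelDeriv_eq {f g : M → M'} {x : M} (h : f =ᶠ[𝓝 x] g) :
    modelDeriv I I' f x = modelDeriv I I' g x :=
  Filter.EventuallyEq.mfderiv_eq h

theorem modelDeriv_const (c : M') (x : M) : modelDeriv I I' (fun _ : M => c) x = 0 :=
  mfderiv_const

theorem modelDeriv_id (x : M) : modelDeriv I I id x = ContinuousLinearMap.id ℝ E :=
  mfderiv_id

/-- A curve with vanishing derivative is locally constant. -/
theorem eventually_eq_of_modelDeriv_eq_zero {E : Type*} [NormedAddCommGroup E] [NormedSpace ℝ E]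
    {M : Type*} [TopologicalSpace M] [ChartedSpace E M] [IsManifold 𝓘(ℝ, E) ∞ M]
    {c : ℝ → M} {t₀ : ℝ}
    (hd : ∀ᶠ t in 𝓝 t₀, MDifferentiableAt 𝓘(ℝ, ℝ) 𝓘(ℝ, E) c t)
    (h0 : ∀ᶠ t in 𝓝 t₀, modelDeriv 𝓘(ℝ, ℝ) 𝓘(ℝ, E) c t = 0) :
    ∀ᶠ t in 𝓝 t₀, c t = c t₀ := by
  have hs : ∀ᶠ t in 𝓝 t₀, c t ∈ (extChartAt 𝓘(ℝ, E) (c t₀)).source :=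
    hd.self_of_nhds.continuousAt (extChartAt_source_mem_nhds _)
  obtain ⟨r, hr, hball⟩ := Metric.eventually_nhds_iff_ball.1 (hd.and (h0.and hs))
  have hφ : ∀ t ∈ Metric.ball t₀ r,
      MDifferentiableAt 𝓘(ℝ, E) 𝓘(ℝ, E) (extChartAt 𝓘(ℝ, E) (c t₀)) (c t) := fun t ht =>
    (contMDiffAt_extChartAt' (n := ∞)
      ((extChartAt_source 𝓘(ℝ, E) (c t₀)) ▸ (hball t ht).2.2)).mdifferentiableAt (by simp)
  have hfd : Set.EqOn (fderiv ℝ (extChartAt 𝓘(ℝ, E) (c t₀) ∘ c)) 0 (Metric.ball t₀ r) := by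
    intro t ht
    have := modelDeriv_comp t (hφ t ht) (hball t ht).1 rfl
    rw [(hball t ht).2.1, ContinuousLinearMap.comp_zero] at this
    exact mfderiv_eq_fderiv.symm.trans this
  have hdiff : DifferentiableOn ℝ (extChartAt 𝓘(ℝ, E) (c t₀) ∘ c) (Metric.ball t₀ r) :=
    fun t ht => (mdifferentiableAt_iff_differentiableAt.1
      ((hφ t ht).comp t (hball t ht).1)).differentiableWithinAt
  filter_upwards [Metric.ball_mem_nhds t₀ hr] with t ht
  refine (extChartAt 𝓘(ℝ, E) (c t₀)).injOn (hball t ht).2.2 (mem_extChartAt_source _) ?_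
  exact Metric.isOpen_ball.is_const_of_fderiv_eq_zero (convex_ball _ _).isPreconnected hdiff hfd ht
    (Metric.mem_ball_self hr)

end ModelDeriv

section FreeActions

open Filter Topology

variable {EP : Type*} [NormedAddCommGroup EP] [NormedSpace ℝ EP]
  {P : Type*} [TopologicalSpace P] [ChartedSpace EP P]
  {EG : Type*} [NormedAddCommGroup EG] [NormedSpace ℝ EG]
  {G : Type*} [Group G] [TopologicalSpace G] [ChartedSpace EG G] [MulAction G P]

variable (EP EG G) in
/-- The derivative at `1` of the orbit map `g ↦ g • p`. -/
def orbitDeriv (p : P) : EG →L[ℝ] EP := modelDeriv 𝓘(ℝ, EG) 𝓘(ℝ, EP) (fun g : G => g • p) 1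

theorem infinitesimalGenerator_eq (ξ : EG) (p : P) :
    (infinitesimalGenerator P EG G ξ p : EP) = orbitDeriv EP EG G p ξ := by
  have key : ∀ (q r : P) (h : q = r) (v : EP),
      ((h ▸ (v : TangentSpace 𝓘(ℝ, EP) q) : TangentSpace 𝓘(ℝ, EP) r) : EP) = v := by
    rintro q _ rfl v; rfl
  exact key _ _ (one_smul G p) _

theorem contMDiff_orbitMap [ContMDiffSMul 𝓘(ℝ, EG) 𝓘(ℝ, EP) ∞ G P] (p : P) :
    ContMDiff 𝓘(ℝ, EG) 𝓘(ℝ, EP) ∞ (fun g : G => g • p) := fun _ =>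
  contMDiffAt_id.smul contMDiffAt_const

theorem orbitMap_deriv_mulInvariantVectorField [LieGroup 𝓘(ℝ, EG) ∞ G]
    [ContMDiffSMul 𝓘(ℝ, EG) 𝓘(ℝ, EP) ∞ G P] (p : P) (g : G) (ξ : EG) :
    modelDeriv 𝓘(ℝ, EG) 𝓘(ℝ, EP) (fun h : G => h • p) g
      (mulInvariantVectorField (I := 𝓘(ℝ, EG)) (G := G) ξ g) =
    modelDeriv 𝓘(ℝ, EP) 𝓘(ℝ, EP) (fun q : P => g • q) p (orbitDeriv EP EG G p ξ) := by
  have ho : ∀ h : G, MDifferentiableAt 𝓘(ℝ, EG) 𝓘(ℝ, EP) (fun h : G => h • p) h := fun h =>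
    (contMDiff_orbitMap p).mdifferentiable (by simp) h
  have hl : MDifferentiableAt 𝓘(ℝ, EG) 𝓘(ℝ, EG) (fun h : G => g * h) 1 :=
    (contMDiff_mul_left (I := 𝓘(ℝ, EG)) (n := ∞)).mdifferentiable (by simp) 1
  have hs : MDifferentiableAt 𝓘(ℝ, EP) 𝓘(ℝ, EP) (fun q : P => g • q) p :=
    (ContMDiffSMul.contMDiff_const_smul (I := 𝓘(ℝ, EG)) (n := ∞) g).mdifferentiable (by simp) p
  have h1 := modelDeriv_comp_apply 1 (ho g) hl (mul_one g) ξ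
  have h2 := modelDeriv_comp_apply 1 hs (ho 1) (one_smul G p) ξ
  have h3 : (fun h : G => h • p) ∘ (fun h : G => g * h) =
      (fun q : P => g • q) ∘ (fun h : G => h • p) := funext fun h => mul_smul g h p
  rw [h3] at h1
  exact h1.symm.trans h2

/-- The orbit maps of a free action are immersions at the identity. -/
theorem orbitDeriv_injective [IsManifold 𝓘(ℝ, EP) ∞ P] [LieGroup 𝓘(ℝ, EG) ∞ G]
    [ContMDiffSMul 𝓘(ℝ, EG) 𝓘(ℝ, EP) ∞ G P] [FiniteDimensional ℝ EG] [IsCancelSMul G P] (p : P) :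
    Function.Injective (orbitDeriv EP EG G p) := by
  rw [injective_iff_map_eq_zero]
  intro ξ hξ
  have : LieGroup 𝓘(ℝ, EG) (minSmoothness ℝ 3) G := by
    simp only [minSmoothness_of_isRCLikeNormedField]
    exact LieGroup.of_le (n := ∞) ENat.LEInfty.out
  have hG : IsManifold 𝓘(ℝ, EG) 1 G := IsManifold.of_le (n := minSmoothness ℝ 3)
    (by simp only [minSmoothness_of_isRCLikeNormedField]; norm_num)
  have hv := (contMDiffAt_mulInvariantVectorField (I := 𝓘(ℝ, EG)) (G := G) ξ (g := 1)).of_le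
    (m := 1) (by simp only [minSmoothness_of_isRCLikeNormedField]; norm_num)
  obtain ⟨γ, hγ1, hγ⟩ := exists_isMIntegralCurveAt_of_contMDiffAt_boundaryless (t₀ := 0) hv
  have hγ' : ∀ᶠ t in 𝓝 (0 : ℝ), MDifferentiableAt 𝓘(ℝ, ℝ) 𝓘(ℝ, EG) γ t ∧
      modelDeriv 𝓘(ℝ, ℝ) 𝓘(ℝ, EG) γ t =
        ContinuousLinearMap.smulRight (1 : ℝ →L[ℝ] ℝ)
          (mulInvariantVectorField (I := 𝓘(ℝ, EG)) (G := G) ξ (γ t) : EG) := by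
    filter_upwards [hγ] with t ht
    exact ⟨ht.mdifferentiableAt, ht.mfderiv⟩
  have ho : ∀ h : G, MDifferentiableAt 𝓘(ℝ, EG) 𝓘(ℝ, EP) (fun h : G => h • p) h := fun h =>
    (contMDiff_orbitMap p).mdifferentiable (by simp) h
  have hconst := eventually_eq_of_modelDeriv_eq_zero (c := (fun h : G => h • p) ∘ γ) (t₀ := 0)
    (hγ'.mono fun t ht => (ho (γ t)).comp t ht.1) (hγ'.mono fun t ht => by
      rw [modelDeriv_comp t (ho (γ t)) ht.1 rfl, ht.2]
      ext
      have := orbitMap_deriv_mulInvariantVectorField (EP := EP) p (γ t) ξ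
      rw [hξ, map_zero] at this
      change modelDeriv 𝓘(ℝ, EG) 𝓘(ℝ, EP) (fun h : G => h • p) (γ t) ((1 : ℝ) •
        (mulInvariantVectorField (I := 𝓘(ℝ, EG)) (G := G) ξ (γ t) : EG)) = 0
      rw [one_smul, this])
  have h1 : γ =ᶠ[𝓝 0] fun _ => 1 := by
    filter_upwards [hconst] with t ht
    have : γ t • p = (1 : G) • p := by simpa [hγ1] using ht
    exact IsCancelSMul.right_cancel _ _ _ this
  have h2 := h1.modelDeriv_eq (I := 𝓘(ℝ, ℝ)) (I' := 𝓘(ℝ, EG))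
  rw [modelDeriv_const, hγ'.self_of_nhds.2, hγ1] at h2
  have h3 : (mulInvariantVectorField (I := 𝓘(ℝ, EG)) (G := G) ξ 1 : EG) = ξ := by
    have : (fun h : G => (1 : G) * h) = id := funext one_mul
    have h4 : modelDeriv 𝓘(ℝ, EG) 𝓘(ℝ, EG) (fun h : G => (1 : G) * h) 1 ξ = ξ := by
      rw [this, modelDeriv_id]; rfl
    exact h4
  rw [h3] at h2
  have h5 : (1 : ℝ) • ξ = 0 := DFunLike.congr_fun h2 (1 : ℝ)
  rwa [one_smul] at h5

end FreeActions

section OrbitProjection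

variable {P : Type*} {G : Type*} [Group G] [MulAction G P]

theorem orbitProj_surjective : Function.Surjective (orbitProj P G) := Quotient.mk_surjective

theorem orbitProj_smul (g : G) (p : P) : orbitProj P G (g • p) = orbitProj P G p :=
  Quotient.sound (MulAction.mem_orbit p g)

theorem exists_smul_eq_of_orbitProj_eq {p p' : P} (h : orbitProj P G p = orbitProj P G p') :
    ∃ g : G, g • p' = p := Quotient.exact h

end OrbitProjection

section PrincipalBundles

open Filter Topology

variable {EP : Type*} [NormedAddCommGroup EP] [NormedSpace ℝ EP]
  {P : Type*} [TopologicalSpace P] [ChartedSpace EP P]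
  {EG : Type*} [NormedAddCommGroup EG] [NormedSpace ℝ EG]
  {G : Type*} [Group G] [TopologicalSpace G] [ChartedSpace EG G] [MulAction G P]
  {EB : Type*} [NormedAddCommGroup EB] [NormedSpace ℝ EB]
  [ChartedSpace EB (MulAction.orbitRel.Quotient G P)]

variable (EP EB G) in
/-- The derivative of the projection onto the orbit space. -/
def orbitProjDeriv (p : P) : EP →L[ℝ] EB := modelDeriv 𝓘(ℝ, EP) 𝓘(ℝ, EB) (orbitProj P G) p

variable [IsManifold 𝓘(ℝ, EP) ∞ P] [LieGroup 𝓘(ℝ, EG) ∞ G]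
  [ContMDiffSMul 𝓘(ℝ, EG) 𝓘(ℝ, EP) ∞ G P]
  [IsManifold 𝓘(ℝ, EB) ∞ (MulAction.orbitRel.Quotient G P)]

theorem exists_localSection_orbitProj [FiniteDimensional ℝ EB]
    (hquot : IsSmoothSubmersion 𝓘(ℝ, EP) 𝓘(ℝ, EB) (orbitProj P G)) (p : P) :
    ∃ σ : MulAction.orbitRel.Quotient G P → P, σ (orbitProj P G p) = p ∧
      ∀ᶠ b in 𝓝 (orbitProj P G p), orbitProj P G (σ b) = b ∧
        ContMDiffAt 𝓘(ℝ, EB) 𝓘(ℝ, EP) ∞ σ b :=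
  exists_contMDiffAt_localSection (Eventually.of_forall fun _ => hquot.1.contMDiffAt) (hquot.2 p)

theorem orbitProjDeriv_orbitDeriv
    (hquot : IsSmoothSubmersion 𝓘(ℝ, EP) 𝓘(ℝ, EB) (orbitProj P G)) (p : P) (ξ : EG) :
    orbitProjDeriv EP G EB p (orbitDeriv EP EG G p ξ) = 0 := by
  have h := modelDeriv_comp_apply (1 : G) (hquot.1.mdifferentiable (by simp) p)
    ((contMDiff_orbitMap (EP := EP) (EG := EG) p).mdifferentiable (by simp) 1) (one_smul G p) ξ
  have hc : orbitProj P G ∘ (fun g : G => g • p) = fun _ => orbitProj P G p :=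
    funext fun g => orbitProj_smul g p
  rw [hc, modelDeriv_const] at h
  exact h.symm

/-- A smooth free action of a second countable Lie group whose orbit projection is a submersion
has enough dimensions: `dim P ≤ dim G + dim P/G`. -/
theorem finrank_le_add_of_submersion [FiniteDimensional ℝ EP] [FiniteDimensional ℝ EB]
    [FiniteDimensional ℝ EG] [SecondCountableTopology G] [SecondCountableTopology P]
    (hquot : IsSmoothSubmersion 𝓘(ℝ, EP) 𝓘(ℝ, EB) (orbitProj P G)) (p : P) :
    Module.finrank ℝ EP ≤ Module.finrank ℝ EG + Module.finrank ℝ EB := by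
  obtain ⟨σ, hσp, hσ⟩ := exists_localSection_orbitProj hquot p
  have : ContinuousSMul G P := 
    ContMDiffSMul.continuousSMul (I := 𝓘(ℝ, EG)) (I' := 𝓘(ℝ, EP)) ∞
  have : SecondCountableTopology (MulAction.orbitRel.Quotient G P) :=
    ContinuousConstSMul.secondCountableTopology
  set φ := extChartAt 𝓘(ℝ, EP) p
  let F : G × MulAction.orbitRel.Quotient G P → P := fun x => x.1 • σ x.2
  let W : Set (G × MulAction.orbitRel.Quotient G P) := {x | (orbitProj P G (σ x.2) = x.2 ∧
        ContMDiffAt 𝓘(ℝ, EB) 𝓘(ℝ, EP) ∞ σ x.2) ∧ F x ∈ φ.source}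
  have hW : ∀ x ∈ W, ContMDiffAt (𝓘(ℝ, EG).prod 𝓘(ℝ, EB)) 𝓘(ℝ, EP) 1 (φ ∘ F) x := by
    rintro x ⟨⟨-, hx⟩, hx'⟩
    have hF : ContMDiffAt (𝓘(ℝ, EG).prod 𝓘(ℝ, EB)) 𝓘(ℝ, EP) ∞ F x :=
      contMDiffAt_fst.smul (hx.comp x contMDiffAt_snd)
    exact ((contMDiffAt_extChartAt' (by simpa [φ] using hx')).comp x hF).of_le (by simp)
  have hle := dimH_image_le_finrank_of_contMDiffAt hW
  have hmem : (φ ∘ F) '' W ∈ 𝓝 (φ p) := by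
    have hφs : Tendsto φ.symm (𝓝 (φ p)) (𝓝 p) := by
      have := continuousAt_extChartAt_symm (I := 𝓘(ℝ, EP)) p
      rwa [ContinuousAt, extChartAt_to_inv] at this
    filter_upwards [(hquot.1.continuous.tendsto p |>.comp hφs).eventually hσ,
      extChartAt_target_mem_nhds (I := 𝓘(ℝ, EP)) p] with y hy hyt
    obtain ⟨g, hg⟩ := exists_smul_eq_of_orbitProj_eq hy.1.symm
    have hF : F (g, orbitProj P G (φ.symm y)) = φ.symm y := hg
    refine ⟨(g, orbitProj P G (φ.symm y)), ⟨hy, ?_⟩, ?_⟩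
    · rw [hF]; exact φ.map_target hyt
    · rw [Function.comp_apply, hF, φ.right_inv hyt]
  rw [Real.dimH_of_mem_nhds hmem, Module.finrank_prod] at hle
  exact_mod_cast hle

/-- The vertical space of a principal bundle consists of the values of the infinitesimal
generators. -/
theorem exists_orbitDeriv_eq [FiniteDimensional ℝ EP] [FiniteDimensional ℝ EB]
    [FiniteDimensional ℝ EG] [SecondCountableTopology G] [SecondCountableTopology P]
    [IsCancelSMul G P]
    (hquot : IsSmoothSubmersion 𝓘(ℝ, EP) 𝓘(ℝ, EB) (orbitProj P G)) (p : P) (v : EP)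
    (hv : orbitProjDeriv EP G EB p v = 0) : ∃ ξ : EG, orbitDeriv EP EG G p ξ = v := by
  let A := (orbitDeriv EP EG G p).toLinearMap
  let D := (orbitProjDeriv EP G EB p).toLinearMap
  have hle : LinearMap.range A ≤ LinearMap.ker D := by
    rintro _ ⟨ξ, rfl⟩
    exact orbitProjDeriv_orbitDeriv hquot p ξ
  have h1 : Module.finrank ℝ (LinearMap.range A) = Module.finrank ℝ EG :=
    LinearMap.finrank_range_of_inj (orbitDeriv_injective p)
  have h2 := D.finrank_range_add_finrank_ker
  have hD : LinearMap.range D = ⊤ := LinearMap.range_eq_top.2 (hquot.2 p)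
  rw [hD, finrank_top] at h2
  have h3 := finrank_le_add_of_submersion (EG := EG) hquot p
  have heq := Submodule.eq_of_le_of_finrank_le hle (by omega)
  have : v ∈ LinearMap.range A := heq ▸ hv
  exact this

/-- Local triviality of a principal bundle: near `p` the points are smooth group multiples of the
values of a smooth section of the orbit projection. -/
theorem exists_local_trivialization [FiniteDimensional ℝ EP] [FiniteDimensional ℝ EB]
    [FiniteDimensional ℝ EG] [SecondCountableTopology G] [SecondCountableTopology P]
    [IsCancelSMul G P]
    (hquot : IsSmoothSubmersion 𝓘(ℝ, EP) 𝓘(ℝ, EB) (orbitProj P G)) (p : P) :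
    ∃ (ρ : P → G) (σ : MulAction.orbitRel.Quotient G P → P),
      ∀ᶠ q in 𝓝 p, ContMDiffAt 𝓘(ℝ, EP) 𝓘(ℝ, EG) ∞ ρ q ∧ q = ρ q • σ (orbitProj P G q) := by
  obtain ⟨σ, hσp, hσ⟩ := exists_localSection_orbitProj hquot p
  set b := orbitProj P G p
  let F : G × MulAction.orbitRel.Quotient G P → P := fun x => x.1 • σ x.2
  have hFb : F (1, b) = p := by simp [F, hσp]
  have hsnd : Tendsto Prod.snd (𝓝 ((1 : G), b)) (𝓝 b) := continuous_snd.tendsto _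
  have hF : ∀ᶠ x in 𝓝 ((1 : G), b),
      ContMDiffAt (𝓘(ℝ, EG).prod 𝓘(ℝ, EB)) 𝓘(ℝ, EP) ∞ F x := by
    filter_upwards [hsnd.eventually hσ] with x hx
    exact contMDiffAt_fst.smul (hx.2.comp x contMDiffAt_snd)
  have hσd := hσ.self_of_nhds.2.mdifferentiableAt (by simp)
  have hsurj : Function.Surjective
      (mfderiv (𝓘(ℝ, EG).prod 𝓘(ℝ, EB)) 𝓘(ℝ, EP) F ((1 : G), b)) := by
    intro (v : EP)
    have hσπ : orbitProjDeriv EP G EB p (modelDeriv 𝓘(ℝ, EB) 𝓘(ℝ, EP) σ b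
        (orbitProjDeriv EP G EB p v)) = orbitProjDeriv EP G EB p v := by
      have h := modelDeriv_comp_apply b (hquot.1.mdifferentiable (by simp) p) hσd hσp
        (orbitProjDeriv EP G EB p v)
      have hid : orbitProj P G ∘ σ =ᶠ[𝓝 b] id := hσ.mono fun _ h => h.1
      rw [hid.modelDeriv_eq, modelDeriv_id] at h
      exact h.symm
    obtain ⟨ξ, hξ⟩ := exists_orbitDeriv_eq (EG := EG) hquot p
      (v - modelDeriv 𝓘(ℝ, EB) 𝓘(ℝ, EP) σ b (orbitProjDeriv EP G EB p v))
      (by rw [map_sub, hσπ, sub_self])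
    refine ⟨((ξ : EG), (orbitProjDeriv EP G EB p v : EB)), ?_⟩
    refine (mfderiv_prod_eq_add_apply (hF.self_of_nhds.mdifferentiableAt (by simp))).trans ?_
    have e1 : (fun g : G => F (g, b)) = fun g : G => g • p := by simp [F, hσp]
    have e2 : (fun c => F ((1 : G), c)) = σ := by simp [F]
    have h1 : modelDeriv 𝓘(ℝ, EG) 𝓘(ℝ, EP) (fun g : G => F (g, b)) 1 ξ =
        orbitDeriv EP EG G p ξ := by rw [e1]; rfl
    have h2 : modelDeriv 𝓘(ℝ, EB) 𝓘(ℝ, EP) (fun c => F ((1 : G), c)) b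
        (orbitProjDeriv EP G EB p v) =
        modelDeriv 𝓘(ℝ, EB) 𝓘(ℝ, EP) σ b (orbitProjDeriv EP G EB p v) := by rw [e2]
    refine (congrArg₂ (fun x y : EP => x + y) h1 h2).trans ?_
    rw [hξ]
    exact sub_add_cancel v _
  obtain ⟨s, hs, hs'⟩ := exists_contMDiffAt_localSection hF hsurj
  rw [hFb] at hs hs'
  have hsnds : Tendsto (fun q => (s q).2) (𝓝 p) (𝓝 b) := by
    have h1 := hs'.self_of_nhds.2.continuousAt
    rw [ContinuousAt, hs] at h1
    exact hsnd.comp h1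
  refine ⟨fun q => (s q).1, σ, ?_⟩
  filter_upwards [hs', hsnds.eventually hσ] with q hq hq'
  refine ⟨contMDiffAt_fst.comp q hq.2, ?_⟩
  have : orbitProj P G q = (s q).2 := by
    conv_lhs => rw [← hq.1]
    exact (orbitProj_smul _ _).trans hq'.1
  rw [this]
  exact hq.1.symm

/-- Two smooth curves with the same projection to the orbit space differ, locally, by a smooth
curve in the group. -/
theorem exists_smooth_division [FiniteDimensional ℝ EP] [FiniteDimensional ℝ EB]
    [FiniteDimensional ℝ EG] [SecondCountableTopology G] [SecondCountableTopology P]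
    [IsCancelSMul G P]
    (hquot : IsSmoothSubmersion 𝓘(ℝ, EP) 𝓘(ℝ, EB) (orbitProj P G))
    {c₁ c₂ : ℝ → P} {t₀ : ℝ}
    (h₁ : ∀ᶠ t in 𝓝 t₀, ContMDiffAt 𝓘(ℝ, ℝ) 𝓘(ℝ, EP) ∞ c₁ t)
    (h₂ : ∀ᶠ t in 𝓝 t₀, ContMDiffAt 𝓘(ℝ, ℝ) 𝓘(ℝ, EP) ∞ c₂ t)
    (h : ∀ᶠ t in 𝓝 t₀, orbitProj P G (c₁ t) = orbitProj P G (c₂ t)) :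
    ∃ g : ℝ → G, ∀ᶠ t in 𝓝 t₀, ContMDiffAt 𝓘(ℝ, ℝ) 𝓘(ℝ, EG) ∞ g t ∧ c₁ t = g t • c₂ t := by
  obtain ⟨g₀, hg₀⟩ := exists_smul_eq_of_orbitProj_eq h.self_of_nhds
  obtain ⟨ρ, σ, hρ⟩ := exists_local_trivialization (EG := EG) hquot (c₂ t₀)
  have hs : ∀ t, ContMDiffAt 𝓘(ℝ, ℝ) 𝓘(ℝ, EP) ∞ c₁ t →
      ContMDiffAt 𝓘(ℝ, ℝ) 𝓘(ℝ, EP) ∞ (fun t => g₀⁻¹ • c₁ t) t := fun t ht =>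
    (contMDiffAt_const (I' := 𝓘(ℝ, EG)) (c := g₀⁻¹)).smul ht
  have ht1 : Tendsto (fun t => g₀⁻¹ • c₁ t) (𝓝 t₀) (𝓝 (c₂ t₀)) := by
    have := (hs t₀ h₁.self_of_nhds).continuousAt
    rwa [ContinuousAt, ← hg₀, inv_smul_smul] at this
  have ht2 : Tendsto c₂ (𝓝 t₀) (𝓝 (c₂ t₀)) := h₂.self_of_nhds.continuousAt
  refine ⟨fun t => g₀ * ρ (g₀⁻¹ • c₁ t) * (ρ (c₂ t))⁻¹, ?_⟩
  filter_upwards [h₁, h₂, h, ht1.eventually hρ, ht2.eventually hρ] with t h1 h2 h3 h4 h5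
  refine ⟨((contMDiffAt_const.mul (h4.1.comp t (hs t h1))).mul (h5.1.comp t h2).inv), ?_⟩
  have h6 := h4.2
  rw [orbitProj_smul, h3] at h6
  have h7 : (ρ (c₂ t))⁻¹ • c₂ t = σ (orbitProj P G (c₂ t)) := by
    rw [inv_smul_eq_iff]; exact h5.2
  rw [mul_smul, mul_smul, h7, ← h6, smul_inv_smul]

end PrincipalBundles

section CurveLifting

open Filter Topology

/-- There are smooth maps from the line into an arbitrarily small ball around `y` which agree with
the identity near `y`. -/
theorem exists_contDiff_retraction_ball (y : ℝ) {r : ℝ} (hr : 0 < r) :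
    ∃ φ : ℝ → ℝ, ContDiff ℝ ∞ φ ∧ φ =ᶠ[𝓝 y] id ∧ ∀ t, φ t ∈ Metric.ball y r := by
  let χ : ContDiffBump y := ⟨r / 4, r / 2, by positivity, by linarith⟩
  refine ⟨fun t => y + (t - y) * χ t, ?_, ?_, fun t => ?_⟩
  · exact contDiff_const.add ((contDiff_id.sub contDiff_const).mul χ.contDiff)
  · filter_upwards [χ.eventuallyEq_one] with t ht
    simp [ht]
  · rw [Metric.mem_ball, Real.dist_eq, add_sub_cancel_left, abs_mul, abs_of_nonneg χ.nonneg]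
    by_cases ht : t ∈ Metric.ball y (r / 2)
    · rw [Metric.mem_ball, Real.dist_eq] at ht
      have := mul_le_mul_of_nonneg_left (χ.le_one (x := t)) (abs_nonneg (t - y))
      linarith
    · have : χ t = 0 := χ.zero_of_le_dist (not_lt.1 ht)
      rw [this, mul_zero]; exact hr

variable {EP : Type*} [NormedAddCommGroup EP] [NormedSpace ℝ EP]
  {P : Type*} [TopologicalSpace P] [ChartedSpace EP P]
  {G : Type*} [Group G] [MulAction G P]

variable (EP) in
/-- Near `t` the curve `c` is a smooth lift of the curve `c'` in the orbit space. -/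
def IsSmoothLiftAt (c' : ℝ → MulAction.orbitRel.Quotient G P) (c : ℝ → P) (t : ℝ) : Prop :=
  ∀ᶠ s in 𝓝 t, ContMDiffAt 𝓘(ℝ, ℝ) 𝓘(ℝ, EP) ∞ c s ∧ orbitProj P G (c s) = c' s

theorem IsSmoothLiftAt.congr {c' : ℝ → MulAction.orbitRel.Quotient G P} {c₁ c₂ : ℝ → P} {t : ℝ}
    (h : IsSmoothLiftAt EP c' c₁ t) (he : c₂ =ᶠ[𝓝 t] c₁) : IsSmoothLiftAt EP c' c₂ t := by
  filter_upwards [h, he.eventually_nhds] with s hs hes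
  exact ⟨hs.1.congr_of_eventuallyEq hes, hes.self_of_nhds ▸ hs.2⟩

variable [IsManifold 𝓘(ℝ, EP) ∞ P]
  {EG : Type*} [NormedAddCommGroup EG] [NormedSpace ℝ EG]
  [TopologicalSpace G] [ChartedSpace EG G] [LieGroup 𝓘(ℝ, EG) ∞ G]
  [ContMDiffSMul 𝓘(ℝ, EG) 𝓘(ℝ, EP) ∞ G P]
  {EB : Type*} [NormedAddCommGroup EB] [NormedSpace ℝ EB]
  [ChartedSpace EB (MulAction.orbitRel.Quotient G P)]
  [IsManifold 𝓘(ℝ, EB) ∞ (MulAction.orbitRel.Quotient G P)]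

section

variable [FiniteDimensional ℝ EP] [FiniteDimensional ℝ EB]
  [FiniteDimensional ℝ EG] [SecondCountableTopology G] [SecondCountableTopology P]
  [IsCancelSMul G P]

include EG EB in
/-- A lift can be modified by a curve in the group so that it agrees with another given lift near
a point. -/
theorem IsSmoothLiftAt.exists_modification
    (hquot : IsSmoothSubmersion 𝓘(ℝ, EP) 𝓘(ℝ, EB) (orbitProj P G))
    {c' : ℝ → MulAction.orbitRel.Quotient G P} {c₁ c₂ : ℝ → P} {y : ℝ}
    (h₁ : IsSmoothLiftAt EP c' c₁ y) (h₂ : IsSmoothLiftAt EP c' c₂ y) :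
    ∃ c : ℝ → P, c =ᶠ[𝓝 y] c₁ ∧ ∀ t, IsSmoothLiftAt EP c' c₂ t → IsSmoothLiftAt EP c' c t := by
  obtain ⟨g, hg⟩ := exists_smooth_division (EG := EG) hquot (h₁.mono fun _ h => h.1)
    (h₂.mono fun _ h => h.1) ((h₁.and h₂).mono fun _ h => h.1.2.trans h.2.2.symm)
  obtain ⟨r, hr, hball⟩ := Metric.eventually_nhds_iff_ball.1 hg
  obtain ⟨φ, hφ, hφy, hφr⟩ := exists_contDiff_retraction_ball y hr
  refine ⟨fun t => g (φ t) • c₂ t, ?_, fun t ht => ?_⟩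
  · filter_upwards [hφy, hg] with t h1 h2
    rw [h1, h2.2]; rfl
  · filter_upwards [ht] with s hs
    refine ⟨?_, (orbitProj_smul _ _).trans hs.2⟩
    exact ((hball _ (hφr s)).1.comp s hφ.contDiffAt.contMDiffAt).smul hs.1

include EG EB in
theorem exists_glued_lift
    (hquot : IsSmoothSubmersion 𝓘(ℝ, EP) 𝓘(ℝ, EB) (orbitProj P G))
    {c' : ℝ → MulAction.orbitRel.Quotient G P} {c₁ c₂ : ℝ → P} {y : ℝ}
    (h₁ : IsSmoothLiftAt EP c' c₁ y) (h₂ : IsSmoothLiftAt EP c' c₂ y)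
    {S : Set ℝ} (hSc : IsClosed S) (hS : ∀ t ∈ S, t ≠ y → S ∈ 𝓝 t) :
    ∃ c : ℝ → P, Set.EqOn c c₁ S ∧ (∀ t ∈ S, IsSmoothLiftAt EP c' c₁ t → IsSmoothLiftAt EP c' c t) ∧
      ∀ t ∉ S, IsSmoothLiftAt EP c' c₂ t → IsSmoothLiftAt EP c' c t := by
  classical
  obtain ⟨c₃, h₃, h₃'⟩ := h₁.exists_modification (EG := EG) hquot h₂
  refine ⟨S.piecewise c₁ c₃, S.piecewise_eqOn _ _, fun t ht h => ?_, fun t ht h => ?_⟩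
  · by_cases hty : t = y
    · subst hty
      refine h.congr ?_
      filter_upwards [h₃] with s hs
      by_cases hsS : s ∈ S <;> simp [hsS, hs]
    · exact h.congr ((S.piecewise_eqOn c₁ c₃).eventuallyEq_of_mem (hS t ht hty))
  · exact (h₃' t h).congr ((S.piecewise_eqOn_compl c₁ c₃).eventuallyEq_of_mem
      (hSc.isOpen_compl.mem_nhds ht))

include EG EB in
theorem exists_lift_uIcc
    (hquot : IsSmoothSubmersion 𝓘(ℝ, EP) 𝓘(ℝ, EB) (orbitProj P G))
    {J : Set ℝ} (hJ : IsOpen J) (hJc : J.OrdConnected)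
    {c' : ℝ → MulAction.orbitRel.Quotient G P} (hc' : ContMDiffOn 𝓘(ℝ, ℝ) 𝓘(ℝ, EB) ∞ c' J)
    {x y : ℝ} (hx : x ∈ J) (hy : y ∈ J) :
    ∃ c : ℝ → P, ∀ t ∈ Set.uIcc x y, IsSmoothLiftAt EP c' c t := by
  have hloc : ∀ t ∈ J, ∃ c : ℝ → P, IsSmoothLiftAt EP c' c t := by
    intro t ht
    obtain ⟨p, hp⟩ := orbitProj_surjective (c' t)
    obtain ⟨σ, -, hσ⟩ := exists_localSection_orbitProj hquot p
    rw [hp] at hσ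
    have hct := (hc'.contMDiffAt (hJ.mem_nhds ht)).continuousAt
    refine ⟨σ ∘ c', ?_⟩
    filter_upwards [hct.eventually hσ, hJ.mem_nhds ht] with s hs hsJ
    exact ⟨hs.2.comp s (hc'.contMDiffAt (hJ.mem_nhds hsJ)), hs.1⟩
  refine hJc.isPreconnected.induction₂ (fun x y : ℝ => ∃ c : ℝ → P, ∀ t ∈ Set.uIcc x y,
    IsSmoothLiftAt EP c' c t) ?_ ?_ ?_ hx hy
  · intro t ht
    obtain ⟨c, hc⟩ := hloc t ht
    obtain ⟨r, hr, hball⟩ := Metric.eventually_nhds_iff_ball.1 (eventually_eventually_nhds.2 hc)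
    refine eventually_nhdsWithin_of_eventually_nhds ?_
    filter_upwards [Metric.ball_mem_nhds t hr] with s hs
    refine ⟨c, fun u hu => hball u ?_⟩
    have hsub : Set.uIcc t s ⊆ Metric.ball t r := by
      rw [Real.ball_eq_Ioo] at hs ⊢
      exact Set.ordConnected_Ioo.uIcc_subset ⟨by linarith, by linarith⟩ hs
    exact hsub hu
  · have key : ∀ x y z : ℝ, x ≤ y → y ≤ z →
        (∃ c : ℝ → P, ∀ t ∈ Set.uIcc x y, IsSmoothLiftAt EP c' c t) →
        (∃ c : ℝ → P, ∀ t ∈ Set.uIcc y z, IsSmoothLiftAt EP c' c t) →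
        ∃ c : ℝ → P, ∀ t ∈ Set.uIcc x z, IsSmoothLiftAt EP c' c t := by
      rintro x y z hxy hyz ⟨c₁, h₁⟩ ⟨c₂, h₂⟩
      obtain ⟨c, -, hc, hc2⟩ := exists_glued_lift (EG := EG) hquot (h₁ y (by simp))
        (h₂ y (by simp)) (S := Set.Iic y) isClosed_Iic
        (fun t ht hty => Iic_mem_nhds (lt_of_le_of_ne ht hty))
      refine ⟨c, fun t ht => ?_⟩
      rw [Set.uIcc_of_le hxy] at h₁
      rw [Set.uIcc_of_le hyz] at h₂
      rw [Set.uIcc_of_le (hxy.trans hyz)] at ht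
      by_cases hty : t ≤ y
      · exact hc t hty (h₁ t ⟨ht.1, hty⟩)
      · exact hc2 t hty (h₂ t ⟨(not_le.1 hty).le, ht.2⟩)
    intro x y z _ _ _ hxy hyz
    by_cases hc : (x ≤ y ∧ y ≤ z) ∨ (z ≤ y ∧ y ≤ x)
    · rcases hc with hc | hc
      · exact key x y z hc.1 hc.2 hxy hyz
      · rw [Set.uIcc_comm] at hxy hyz ⊢
        exact key z y x hc.1 hc.2 hyz hxy
    · have hsub : Set.uIcc x z ⊆ Set.uIcc x y ∨ Set.uIcc x z ⊆ Set.uIcc y z := by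
        simp only [Set.uIcc_subset_uIcc_iff_mem, Set.mem_uIcc]
        grind
      rcases hsub with h | h
      · exact hxy.imp fun c hc t ht => hc t (h ht)
      · exact hyz.imp fun c hc t ht => hc t (h ht)
  · intro x y _ _ h
    rwa [Set.uIcc_comm]

include EG EB in
theorem exists_lift_extension
    (hquot : IsSmoothSubmersion 𝓘(ℝ, EP) 𝓘(ℝ, EB) (orbitProj P G))
    {J : Set ℝ} (hJ : IsOpen J) (hJc : J.OrdConnected)
    {c' : ℝ → MulAction.orbitRel.Quotient G P} (hc' : ContMDiffOn 𝓘(ℝ, ℝ) 𝓘(ℝ, EB) ∞ c' J)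
    {a b d : ℝ} (ha : a ∈ J) (hb : b ∈ J) (hd : d ∈ J) (hab : a ≤ b)
    {c₀ : ℝ → P} (h₀ : ∀ t ∈ Set.Icc a b, IsSmoothLiftAt EP c' c₀ t) :
    ∃ c : ℝ → P, Set.EqOn c c₀ (Set.Icc a b) ∧
      ∀ t ∈ Set.Icc (min a d) (max b d), IsSmoothLiftAt EP c' c t := by
  obtain ⟨c₁, h₁⟩ := exists_lift_uIcc (EG := EG) hquot hJ hJc hc' hb (y := max b d)
    (by rcases max_choice b d with h | h <;> rwa [h])
  obtain ⟨c₂, h₂⟩ := exists_lift_uIcc (EG := EG) hquot hJ hJc hc' ha (y := min a d)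
    (by rcases min_choice a d with h | h <;> rwa [h])
  obtain ⟨c₃, he₃, h₃, h₃'⟩ := exists_glued_lift (EG := EG) hquot (h₀ b ⟨hab, le_rfl⟩)
    (h₁ b (by simp)) (S := Set.Iic b) isClosed_Iic
    (fun t ht hty => Iic_mem_nhds (lt_of_le_of_ne ht hty))
  have h₃a : ∀ t ∈ Set.Icc a (max b d), IsSmoothLiftAt EP c' c₃ t := by
    intro t ht
    by_cases htb : t ≤ b
    · exact h₃ t htb (h₀ t ⟨ht.1, htb⟩)
    · refine h₃' t htb (h₁ t ?_)
      rw [Set.uIcc_of_le (le_max_left b d)]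
      exact ⟨(not_le.1 htb).le, ht.2⟩
  obtain ⟨c, he, h, h'⟩ := exists_glued_lift (EG := EG) hquot
    (h₃a a ⟨le_rfl, hab.trans (le_max_left b d)⟩)
    (h₂ a (by simp)) (S := Set.Ici a) isClosed_Ici
    (fun t ht hty => Ici_mem_nhds (lt_of_le_of_ne ht (Ne.symm hty)))
  refine ⟨c, fun t ht => (he ht.1).trans (he₃ ht.2), fun t ht => ?_⟩
  by_cases hta : a ≤ t
  · exact h t hta (h₃a t ⟨hta, ht.2⟩)
  · refine h' t hta (h₂ t ?_)
    rw [Set.uIcc_of_ge (min_le_left a d)]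
    exact ⟨ht.1, (not_le.1 hta).le⟩

include EG in
/-- Smooth curves in the orbit space, defined on an open interval, have smooth lifts on the same
interval. -/
theorem exists_smooth_lift
    (hquot : IsSmoothSubmersion 𝓘(ℝ, EP) 𝓘(ℝ, EB) (orbitProj P G))
    {J : Set ℝ} (hJ : IsOpen J) (hJc : J.OrdConnected)
    {c' : ℝ → MulAction.orbitRel.Quotient G P} (hc' : ContMDiffOn 𝓘(ℝ, ℝ) 𝓘(ℝ, EB) ∞ c' J) :
    ∃ c : ℝ → P, ∀ t ∈ J, IsSmoothLiftAt EP c' c t := by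
  rcases J.eq_empty_or_nonempty with rfl | ⟨x₀, hx₀⟩
  · exact ⟨fun t => (c' t).out, by simp⟩
  have : Nonempty J := ⟨⟨x₀, hx₀⟩⟩
  obtain ⟨D, hD⟩ := TopologicalSpace.exists_dense_seq J
  let T := {s : ℝ × ℝ × (ℝ → P) // s.1 ∈ J ∧ s.2.1 ∈ J ∧ s.1 ≤ s.2.1 ∧
    ∀ t ∈ Set.Icc s.1 s.2.1, IsSmoothLiftAt EP c' s.2.2 t}
  have step : ∀ (d : J) (s : T), ∃ s' : T, s'.1.1 = min s.1.1 d ∧ s'.1.2.1 = max s.1.2.1 d ∧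
      Set.EqOn s'.1.2.2 s.1.2.2 (Set.Icc s.1.1 s.1.2.1) := by
    rintro d ⟨⟨a, b, c₀⟩, ha, hb, hab, h⟩
    obtain ⟨c, hc, hc'⟩ := exists_lift_extension (EG := EG) hquot hJ hJc hc' ha hb d.2 hab h
    refine ⟨⟨⟨min a d, max b d, c⟩, ?_, ?_, (min_le_left _ _).trans (hab.trans (le_max_left _ _)),
      hc'⟩, rfl, rfl, hc⟩
    · rcases min_choice a (d : ℝ) with h | h <;> simp only [h]
      exacts [ha, d.2]
    · rcases max_choice b (d : ℝ) with h | h <;> simp only [h]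
      exacts [hb, d.2]
  choose next hn1 hn2 hn3 using step
  obtain ⟨c₀, hc₀⟩ := exists_lift_uIcc (EG := EG) hquot hJ hJc hc' hx₀ hx₀
  let s₀ : T := ⟨⟨x₀, x₀, c₀⟩, hx₀, hx₀, le_rfl, by simpa using hc₀⟩
  let s : ℕ → T := fun n => Nat.rec s₀ (fun n t => next (D n) t) n
  have hs : ∀ n, s (n + 1) = next (D n) (s n) := fun n => rfl
  let K : ℕ → Set ℝ := fun n => Set.Icc (s n).1.1 (s n).1.2.1
  have hmono1 : ∀ n, K n ⊆ K (n + 1) ∧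
      Set.EqOn (s (n + 1)).1.2.2 (s n).1.2.2 (K n) := by
    intro n
    simp only [K, hs, hn1, hn2]
    exact ⟨Set.Icc_subset_Icc (min_le_left _ _) (le_max_left _ _), hn3 (D n) (s n)⟩
  have hmono : Monotone K := monotone_nat_of_le_succ fun n => (hmono1 n).1
  have heq : ∀ m n, m ≤ n → Set.EqOn (s n).1.2.2 (s m).1.2.2 (K m) := by
    intro m n hmn
    induction n, hmn using Nat.le_induction with
    | base => exact fun _ _ => rfl
    | succ n hmn ih => exact fun t ht => ((hmono1 n).2 (hmono hmn ht)).trans (ih ht)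
  have hDK : ∀ n, (D n : ℝ) ∈ K (n + 1) := by
    intro n
    simp only [K, hs, hn1, hn2]
    exact ⟨min_le_right _ _, le_max_right _ _⟩
  have hcover : ∀ t ∈ J, ∃ n, K n ∈ 𝓝 t := by
    intro t ht
    obtain ⟨r, hr, hball⟩ := Metric.isOpen_iff.1 hJ t ht
    have h1 : ∃ n, (D n : ℝ) < t := hD.exists_mem_open (isOpen_Iio.preimage continuous_subtype_val)
      ⟨⟨t - r / 2, hball (by rw [Metric.mem_ball, Real.dist_eq, abs_lt]; constructor <;> linarith)⟩,
        by simp only [Set.mem_preimage, Set.mem_Iio]; linarith⟩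
    have h2 : ∃ n, t < (D n : ℝ) := hD.exists_mem_open (isOpen_Ioi.preimage continuous_subtype_val)
      ⟨⟨t + r / 2, hball (by rw [Metric.mem_ball, Real.dist_eq, abs_lt]; constructor <;> linarith)⟩,
        by simp only [Set.mem_preimage, Set.mem_Ioi]; linarith⟩
    obtain ⟨m, hm⟩ := h1
    obtain ⟨n, hn⟩ := h2
    have hm' := hmono (le_max_left (m + 1) (n + 1)) (hDK m)
    have hn' := hmono (le_max_right (m + 1) (n + 1)) (hDK n)
    exact ⟨max (m + 1) (n + 1), Icc_mem_nhds (hm'.1.trans_lt hm) (hn.trans_le hn'.2)⟩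
  choose! N hN using hcover
  refine ⟨fun t => (s (N t)).1.2.2 t, fun t ht => ?_⟩
  refine ((s (N t)).2.2.2.2 t (mem_of_mem_nhds (hN t ht))).congr ?_
  filter_upwards [hN t ht, hJ.mem_nhds ht] with u hu huJ
  have hu' : u ∈ K (N u) := mem_of_mem_nhds (hN u huJ)
  rcases le_total (N u) (N t) with h | h
  · exact (heq _ _ h hu').symm
  · exact heq _ _ h hu

end

end CurveLifting

section AlternatingMaps

variable {E : Type*} [NormedAddCommGroup E] [NormedSpace ℝ E] [FiniteDimensional ℝ E]
  {F : Type*} [NormedAddCommGroup F] [NormedSpace ℝ F] {k : ℕ}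

variable (E k) in
/-- The values of an alternating map on the tuples of basis vectors. -/
def alternatingEval : (E [⋀^Fin k]→L[ℝ] ℝ) →ₗ[ℝ] ((Fin k → Fin (Module.finrank ℝ E)) → ℝ) where
  toFun α v := α fun i => Module.finBasis ℝ E (v i)
  map_add' _ _ := rfl
  map_smul' _ _ := rfl

theorem alternatingEval_injective : Function.Injective (alternatingEval E k) := by
  intro α β h
  have h' : α.toMultilinearMap = β.toMultilinearMap :=
    Module.Basis.ext_multilinear (fun _ => Module.finBasis ℝ E) fun v => congrFun h v
  ext v
  exact DFunLike.congr_fun h' v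

instance finiteDimensional_continuousAlternatingMap :
    FiniteDimensional ℝ (E [⋀^Fin k]→L[ℝ] ℝ) :=
  FiniteDimensional.of_injective _ (alternatingEval_injective (E := E) (k := k))

theorem contDiffAt_alternating_of_apply {n : ℕ∞ω} {α : F → E [⋀^Fin k]→L[ℝ] ℝ} {x : F}
    (h : ∀ v : Fin k → E, ContDiffAt ℝ n (fun y => α y v) x) : ContDiffAt ℝ n α x := by
  obtain ⟨A, hA⟩ := (alternatingEval E k).exists_leftInverse_of_injective
    (LinearMap.ker_eq_bot.2 alternatingEval_injective)
  have h1 : ContDiffAt ℝ n (fun y => alternatingEval E k (α y)) x :=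
    contDiffAt_pi.2 fun v => h _
  have h2 := (LinearMap.toContinuousLinearMap A).contDiff.contDiffAt.comp x h1
  convert! h2 using 1
  ext1 y
  exact (LinearMap.congr_fun hA (α y)).symm

theorem ContDiffAt.compContinuousLinearMap_alternating {n : ℕ∞ω}
    {E' : Type*} [NormedAddCommGroup E'] [NormedSpace ℝ E'] [FiniteDimensional ℝ E']
    {α : F → E [⋀^Fin k]→L[ℝ] ℝ} {A : F → E' →L[ℝ] E} {x : F}
    (hα : ContDiffAt ℝ n α x) (hA : ContDiffAt ℝ n A x) :
    ContDiffAt ℝ n (fun y => (α y).compContinuousLinearMap (A y)) x := by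
  refine contDiffAt_alternating_of_apply fun v => ?_
  let b := Module.finBasis ℝ (E [⋀^Fin k]→L[ℝ] ℝ)
  have hsum : ∀ y, (α y).compContinuousLinearMap (A y) v =
      ∑ j, b.repr (α y) j * b j (fun i => A y (v i)) := by
    intro y
    have h := DFunLike.congr_fun (b.sum_repr (α y)) fun i => A y (v i)
    rw [ContinuousAlternatingMap.sum_apply] at h
    exact h.symm
  simp_rw [hsum]
  refine ContDiffAt.sum fun j _ => ContDiffAt.mul ?_ ?_
  · exact (LinearMap.toContinuousLinearMap (b.coord j)).contDiff.contDiffAt.comp x hα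
  · have hm : ContDiff ℝ n (b j).toContinuousMultilinearMap :=
      (b j).toContinuousMultilinearMap.contDiff
    exact hm.contDiffAt.comp x (contDiffAt_pi.2 fun i => hA.clm_apply contDiffAt_const)

end AlternatingMaps

section Pullback

open Filter Topology

variable {E : Type*} [NormedAddCommGroup E] [NormedSpace ℝ E]
  {M : Type*} [TopologicalSpace M] [ChartedSpace E M]
  {E' : Type*} [NormedAddCommGroup E'] [NormedSpace ℝ E']
  {M' : Type*} [TopologicalSpace M'] [ChartedSpace E' M'] {k : ℕ}

/-- The value of a form, regarded as an alternating map on the model vector space. -/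
def DForm.onModel {H : Type*} [TopologicalSpace H] {I : ModelWithCorners ℝ E H}
    {N : Type*} [TopologicalSpace N] [ChartedSpace H N] (η : DForm I N k) (x : N) :
    E [⋀^Fin k]→L[ℝ] ℝ := η x

theorem DForm.inChart_eq (η : DForm 𝓘(ℝ, E) M k) (x : M) (y : E) :
    η.inChart x y = (η.onModel ((extChartAt 𝓘(ℝ, E) x).symm y)).compContinuousLinearMap
      (modelDeriv 𝓘(ℝ, E) 𝓘(ℝ, E) (extChartAt 𝓘(ℝ, E) x).symm y) := rfl

theorem DForm.onModel_pullback (f : M → M') (η : DForm 𝓘(ℝ, E') M' k) (x : M) :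
    DForm.onModel (I := 𝓘(ℝ, E)) (DForm.pullback f η) x =
      (η.onModel (f x)).compContinuousLinearMap (modelDeriv 𝓘(ℝ, E) 𝓘(ℝ, E') f x) := rfl

variable [IsManifold 𝓘(ℝ, E) ∞ M] [IsManifold 𝓘(ℝ, E') ∞ M']

/-- In charts, the pullback of a form is the pullback by the expression of the map in the charts. -/
theorem DForm.inChart_pullback_eventuallyEq {η : DForm 𝓘(ℝ, E') M' k} {η' : DForm 𝓘(ℝ, E) M k}
    {f : M → M'} {x : M} {y : E} (hy : y ∈ (extChartAt 𝓘(ℝ, E) x).target)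
    (h : ∀ᶠ z in 𝓝 ((extChartAt 𝓘(ℝ, E) x).symm y), MDifferentiableAt 𝓘(ℝ, E) 𝓘(ℝ, E') f z ∧
      η'.onModel z = (η.onModel (f z)).compContinuousLinearMap
        (modelDeriv 𝓘(ℝ, E) 𝓘(ℝ, E') f z)) {p : M'}
    (hp : f ((extChartAt 𝓘(ℝ, E) x).symm y) ∈ (extChartAt 𝓘(ℝ, E') p).source) :
    η'.inChart x =ᶠ[𝓝 y] fun y' =>
      (η.inChart p ((extChartAt 𝓘(ℝ, E') p ∘ f ∘ (extChartAt 𝓘(ℝ, E) x).symm) y')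
        ).compContinuousLinearMap
        (fderiv ℝ (extChartAt 𝓘(ℝ, E') p ∘ f ∘ (extChartAt 𝓘(ℝ, E) x).symm) y') := by
  set φ := extChartAt 𝓘(ℝ, E) x
  set ψ := extChartAt 𝓘(ℝ, E') p
  have hcφ : Tendsto φ.symm (𝓝 y) (𝓝 (φ.symm y)) := continuousAt_extChartAt_symm'' hy
  have hcf : Tendsto f (𝓝 (φ.symm y)) (𝓝 (f (φ.symm y))) := h.self_of_nhds.1.continuousAt
  have hsrc : ∀ᶠ y' in 𝓝 y, f (φ.symm y') ∈ ψ.source :=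
    (hcf.comp hcφ).eventually ((isOpen_extChartAt_source p).mem_nhds hp)
  filter_upwards [hcφ.eventually h, hsrc.eventually_nhds, extChartAt_target_mem_nhds' hy]
    with y' h1 h2 h3
  have hφd : MDifferentiableAt 𝓘(ℝ, E) 𝓘(ℝ, E) φ.symm y' :=
    ((contMDiffOn_extChartAt_symm (n := ∞) x).contMDiffAt
      (extChartAt_target_mem_nhds' h3)).mdifferentiableAt (by simp)
  have h2' := h2.self_of_nhds
  have hψd : MDifferentiableAt 𝓘(ℝ, E') 𝓘(ℝ, E') ψ (f (φ.symm y')) :=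
    (contMDiffAt_extChartAt' (n := ∞)
      ((extChartAt_source 𝓘(ℝ, E') p) ▸ h2')).mdifferentiableAt (by simp)
  have hψsd : MDifferentiableAt 𝓘(ℝ, E') 𝓘(ℝ, E') ψ.symm (ψ (f (φ.symm y'))) :=
    ((contMDiffOn_extChartAt_symm (n := ∞) p).contMDiffAt
      (extChartAt_target_mem_nhds' (ψ.map_source h2'))).mdifferentiableAt (by simp)
  have hu : MDifferentiableAt 𝓘(ℝ, E) 𝓘(ℝ, E') (ψ ∘ f ∘ φ.symm) y' :=
    hψd.comp y' (h1.1.comp y' hφd)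
  have hfd : fderiv ℝ (ψ ∘ f ∘ φ.symm) y' =
      modelDeriv 𝓘(ℝ, E) 𝓘(ℝ, E') (ψ ∘ f ∘ φ.symm) y' := mfderiv_eq_fderiv.symm
  have hcomp : (modelDeriv 𝓘(ℝ, E) 𝓘(ℝ, E') f (φ.symm y')).comp
        (modelDeriv 𝓘(ℝ, E) 𝓘(ℝ, E) φ.symm y') =
      (modelDeriv 𝓘(ℝ, E') 𝓘(ℝ, E') ψ.symm (ψ (f (φ.symm y')))).comp
        (modelDeriv 𝓘(ℝ, E) 𝓘(ℝ, E') (ψ ∘ f ∘ φ.symm) y') := by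
    rw [← modelDeriv_comp y' h1.1 hφd rfl, ← modelDeriv_comp y' hψsd hu rfl]
    refine Filter.EventuallyEq.modelDeriv_eq ?_
    filter_upwards [h2] with z hz
    exact (ψ.left_inv hz).symm
  rw [DForm.inChart_eq, h1.2, DForm.inChart_eq, hfd]
  have hinv : ψ.symm ((ψ ∘ f ∘ φ.symm) y') = f (φ.symm y') := ψ.left_inv h2'
  rw [hinv]
  ext v
  refine congrArg (η.onModel (f (φ.symm y'))) (funext fun i => ?_)
  exact DFunLike.congr_fun hcomp (v i)

/-- A form which is locally the pullback of smooth forms by smooth maps is smooth. -/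
theorem DForm.isSmooth_of_local_pullback [FiniteDimensional ℝ E] [FiniteDimensional ℝ E']
    {η : DForm 𝓘(ℝ, E') M' k} {η' : DForm 𝓘(ℝ, E) M k} (hη : η.IsSmooth)
    (h : ∀ z₀ : M, ∃ f : M → M', ∀ᶠ z in 𝓝 z₀, ContMDiffAt 𝓘(ℝ, E) 𝓘(ℝ, E') ∞ f z ∧
      η'.onModel z = (η.onModel (f z)).compContinuousLinearMap
        (modelDeriv 𝓘(ℝ, E) 𝓘(ℝ, E') f z)) : η'.IsSmooth := by
  intro x y hy
  obtain ⟨f, hf⟩ := h ((extChartAt 𝓘(ℝ, E) x).symm y)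
  set p := f ((extChartAt 𝓘(ℝ, E) x).symm y) with hp
  have hps : p ∈ (extChartAt 𝓘(ℝ, E') p).source := mem_extChartAt_source p
  have he := DForm.inChart_pullback_eventuallyEq hy
    (hf.mono fun z hz => ⟨hz.1.mdifferentiableAt (by simp), hz.2⟩) (p := p) hps
  refine ContDiffAt.contDiffWithinAt (ContDiffAt.congr_of_eventuallyEq ?_ he)
  have hu : ContDiffAt ℝ ∞ (extChartAt 𝓘(ℝ, E') p ∘ f ∘ (extChartAt 𝓘(ℝ, E) x).symm) y :=
    contDiffAt_comp_extChartAt_symm (f := extChartAt 𝓘(ℝ, E') p ∘ f) hy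
      (contMDiffAt_extChartAt.comp _ hf.self_of_nhds.1)
  refine ContDiffAt.compContinuousLinearMap_alternating ?_ (hu.fderiv_right (m := ∞) (by simp))
  have hη' : ContDiffAt ℝ ∞ (η.inChart p) (extChartAt 𝓘(ℝ, E') p p) :=
    (hη p).contDiffAt (extChartAt_target_mem_nhds p)
  exact hη'.comp y hu

theorem DForm.extDeriv_inChart_eq_zero {η : DForm 𝓘(ℝ, E) M k} (hη : η.IsClosed) (x : M) :
    extDeriv (η.inChart x) (extChartAt 𝓘(ℝ, E) x x) = 0 := by
  have hd : (extDeriv (η.inChart x) (extChartAt 𝓘(ℝ, E) x x)).compContinuousLinearMap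
      (modelDeriv 𝓘(ℝ, E) 𝓘(ℝ, E) (extChartAt 𝓘(ℝ, E) x) x) = 0 := hη x
  have hs := modelDeriv_comp (I := 𝓘(ℝ, E)) (I' := 𝓘(ℝ, E)) (I'' := 𝓘(ℝ, E))
    (extChartAt 𝓘(ℝ, E) x x)
    ((contMDiffAt_extChartAt (n := ∞)).mdifferentiableAt (by simp))
    (((contMDiffOn_extChartAt_symm (n := ∞) x).contMDiffAt
      (extChartAt_target_mem_nhds x)).mdifferentiableAt (by simp)) (extChartAt_to_inv x)
  have hid : extChartAt 𝓘(ℝ, E) x ∘ (extChartAt 𝓘(ℝ, E) x).symm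
      =ᶠ[𝓝 (extChartAt 𝓘(ℝ, E) x x)] id := by
    filter_upwards [extChartAt_target_mem_nhds (I := 𝓘(ℝ, E)) x] with y hy
    exact (extChartAt 𝓘(ℝ, E) x).right_inv hy
  rw [hid.modelDeriv_eq, modelDeriv_id] at hs
  ext v
  have := DFunLike.congr_fun hd fun i =>
    modelDeriv 𝓘(ℝ, E) 𝓘(ℝ, E) (extChartAt 𝓘(ℝ, E) x).symm (extChartAt 𝓘(ℝ, E) x x) (v i)
  refine Eq.trans (congrArg _ (funext fun i => ?_)) this
  exact DFunLike.congr_fun hs (v i)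

/-- A form which is locally the pullback of a smooth closed form by smooth maps is closed. -/
theorem DForm.isClosed_of_local_pullback
    {η : DForm 𝓘(ℝ, E') M' k} {η' : DForm 𝓘(ℝ, E) M k} (hη : η.IsSmooth) (hηc : η.IsClosed)
    (h : ∀ z₀ : M, ∃ f : M → M', ∀ᶠ z in 𝓝 z₀, ContMDiffAt 𝓘(ℝ, E) 𝓘(ℝ, E') ∞ f z ∧
      η'.onModel z = (η.onModel (f z)).compContinuousLinearMap
        (modelDeriv 𝓘(ℝ, E) 𝓘(ℝ, E') f z)) : η'.IsClosed := by
  intro x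
  obtain ⟨f, hf⟩ := h x
  have hy := mem_extChartAt_target (I := 𝓘(ℝ, E)) x
  have hx : (extChartAt 𝓘(ℝ, E) x).symm (extChartAt 𝓘(ℝ, E) x x) = x := extChartAt_to_inv x
  have he := DForm.inChart_pullback_eventuallyEq (η := η) (η' := η') (f := f) hy
    (by rw [hx]; exact hf.mono fun z hz => ⟨hz.1.mdifferentiableAt (by simp), hz.2⟩) (p := f x)
    (by rw [hx]; exact mem_extChartAt_source _)
  have hu : ContDiffAt ℝ ∞ (extChartAt 𝓘(ℝ, E') (f x) ∘ f ∘ (extChartAt 𝓘(ℝ, E) x).symm)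
      (extChartAt 𝓘(ℝ, E) x x) :=
    contDiffAt_comp_extChartAt_symm (f := extChartAt 𝓘(ℝ, E') (f x) ∘ f) hy
      (by rw [hx]; exact contMDiffAt_extChartAt.comp _ hf.self_of_nhds.1)
  have hux : (extChartAt 𝓘(ℝ, E') (f x) ∘ f ∘ (extChartAt 𝓘(ℝ, E) x).symm)
      (extChartAt 𝓘(ℝ, E) x x) = extChartAt 𝓘(ℝ, E') (f x) (f x) := by
    simp only [Function.comp_apply, hx]
  have hη' : DifferentiableAt ℝ (η.inChart (f x)) (extChartAt 𝓘(ℝ, E') (f x) (f x)) :=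
    ((hη (f x)).contDiffAt (extChartAt_target_mem_nhds _)).differentiableAt (by simp)
  have h0 : extDeriv (η'.inChart x) (extChartAt 𝓘(ℝ, E) x x) = 0 := by
    rw [he.extDeriv_eq, extDeriv_pullback (by rwa [hux]) hu
      (by simp only [minSmoothness_of_isRCLikeNormedField]; exact ENat.LEInfty.out), hux,
      DForm.extDeriv_inChart_eq_zero hηc]
    ext v; rfl
  rw [DForm.d, h0]
  ext v; rfl

end Pullback

section BasicForms

open Filter Topology

theorem ContinuousAlternatingMap.apply_eq_of_sub_mem {E : Type*} [NormedAddCommGroup E]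
    [NormedSpace ℝ E] (α : E [⋀^Fin 2]→L[ℝ] ℝ) {K : Submodule ℝ E}
    (hK : ∀ κ ∈ K, ∀ w, α ![κ, w] = 0) {v w : Fin 2 → E} (h : ∀ i, v i - w i ∈ K) :
    α v = α w := by
  have hupd : ∀ a x c : E, Function.update ![x, c] 0 a = ![a, c] := by
    intro a x c
    ext i; fin_cases i <;> rfl
  have hsub : ∀ a b c : E, α ![a, c] - α ![b, c] = α ![a - b, c] := by
    intro a b c
    have := α.map_update_sub ![a, c] 0 a b
    rw [hupd, hupd, hupd] at this
    exact this.symm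
  have hswap : ∀ a b : E, α ![a, b] = - α ![b, a] := by
    intro a b
    have h := α.map_swap ![b, a] (i := 0) (j := 1) (by decide)
    refine Eq.trans (congrArg α ?_) h
    ext i; fin_cases i <;> rfl
  have hstep : ∀ a b c : E, a - b ∈ K → α ![a, c] = α ![b, c] := fun a b c hab => by
    rw [← sub_eq_zero, hsub, hK _ hab]
  have hv : v = ![v 0, v 1] := by ext i; fin_cases i <;> rfl
  have hw : w = ![w 0, w 1] := by ext i; fin_cases i <;> rfl
  rw [hv, hw, hstep _ _ _ (h 0), hswap, hstep _ _ _ (h 1), ← hswap]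

theorem DForm.pullback_orbitProj_injective {EP : Type*} [NormedAddCommGroup EP] [NormedSpace ℝ EP]
    {P : Type*} [TopologicalSpace P] [ChartedSpace EP P] {G : Type*} [Group G] [MulAction G P]
    {EB : Type*} [NormedAddCommGroup EB] [NormedSpace ℝ EB]
    [ChartedSpace EB (MulAction.orbitRel.Quotient G P)] {k : ℕ}
    (hquot : IsSmoothSubmersion 𝓘(ℝ, EP) 𝓘(ℝ, EB) (orbitProj P G))
    {η₁ η₂ : DForm 𝓘(ℝ, EB) (MulAction.orbitRel.Quotient G P) k}
    (h : DForm.pullback (I := 𝓘(ℝ, EP)) (orbitProj P G) η₁ = DForm.pullback (orbitProj P G) η₂) :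
    η₁ = η₂ := by
  funext b
  obtain ⟨p, rfl⟩ := orbitProj_surjective b
  have hp := congrFun h p
  ext v
  choose w hw using fun i => hquot.2 p (v i)
  have h1 := DFunLike.congr_fun hp w
  have hw' : v = fun i => mfderiv 𝓘(ℝ, EP) 𝓘(ℝ, EB) (orbitProj P G) p (w i) :=
    funext fun i => (hw i).symm
  rw [hw']
  exact h1

variable {EP : Type*} [NormedAddCommGroup EP] [NormedSpace ℝ EP] [FiniteDimensional ℝ EP]
  {P : Type*} [TopologicalSpace P] [ChartedSpace EP P] [SecondCountableTopology P]
  [IsManifold 𝓘(ℝ, EP) ∞ P]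
  {EG : Type*} [NormedAddCommGroup EG] [NormedSpace ℝ EG] [FiniteDimensional ℝ EG]
  {G : Type*} [Group G] [TopologicalSpace G] [ChartedSpace EG G] [SecondCountableTopology G]
  [LieGroup 𝓘(ℝ, EG) ∞ G]
  [MulAction G P] [ContMDiffSMul 𝓘(ℝ, EG) 𝓘(ℝ, EP) ∞ G P] [IsCancelSMul G P]
  {EB : Type*} [NormedAddCommGroup EB] [NormedSpace ℝ EB] [FiniteDimensional ℝ EB]
  [ChartedSpace EB (MulAction.orbitRel.Quotient G P)]
  [IsManifold 𝓘(ℝ, EB) ∞ (MulAction.orbitRel.Quotient G P)]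

/-- A pointwise descended form is locally the pullback of the original one by sections. -/
theorem DForm.exists_local_pullback_of_pullback_orbitProj {k : ℕ}
    (hquot : IsSmoothSubmersion 𝓘(ℝ, EP) 𝓘(ℝ, EB) (orbitProj P G))
    {η : DForm 𝓘(ℝ, EP) P k} {η' : DForm 𝓘(ℝ, EB) (MulAction.orbitRel.Quotient G P) k}
    (h : DForm.pullback (orbitProj P G) η' = η) (b₀ : MulAction.orbitRel.Quotient G P) :
    ∃ σ : MulAction.orbitRel.Quotient G P → P, ∀ᶠ b in 𝓝 b₀,
      ContMDiffAt 𝓘(ℝ, EB) 𝓘(ℝ, EP) ∞ σ b ∧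
      η'.onModel b = (η.onModel (σ b)).compContinuousLinearMap
        (modelDeriv 𝓘(ℝ, EB) 𝓘(ℝ, EP) σ b) := by
  obtain ⟨p, rfl⟩ := orbitProj_surjective b₀
  obtain ⟨σ, -, hσ⟩ := exists_localSection_orbitProj hquot p
  refine ⟨σ, ?_⟩
  filter_upwards [hσ.eventually_nhds] with b hb
  have hb' := hb.self_of_nhds
  refine ⟨hb'.2, ?_⟩
  have hid : orbitProj P G ∘ σ =ᶠ[𝓝 b] id := hb.mono fun _ h => h.1
  have hd := modelDeriv_comp b (hquot.1.mdifferentiable (by simp) (σ b))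
    (hb'.2.mdifferentiableAt (by simp)) rfl
  rw [hid.modelDeriv_eq, modelDeriv_id] at hd
  rw [← h, DForm.onModel_pullback, hb'.1]
  ext v
  refine congrArg (η'.onModel b) (funext fun i => ?_)
  exact DFunLike.congr_fun hd (v i)

/-- A smooth closed basic 2-form on the total space of a principal bundle descends to a smooth
closed form on the base. -/
theorem DForm.exists_descended
    (hquot : IsSmoothSubmersion 𝓘(ℝ, EP) 𝓘(ℝ, EB) (orbitProj P G))
    {η : DForm 𝓘(ℝ, EP) P 2} (hη : η.IsSmooth) (hηc : η.IsClosed)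
    (hinv : ∀ g : G, DForm.pullback (fun p : P => g • p) η = η)
    (hhor : ∀ (ξ : EG) (p : P) (w : EP), η.onModel p ![orbitDeriv EP EG G p ξ, w] = 0) :
    ∃ η' : DForm 𝓘(ℝ, EB) (MulAction.orbitRel.Quotient G P) 2,
      η'.IsSmooth ∧ η'.IsClosed ∧ DForm.pullback (orbitProj P G) η' = η := by
  have hR : ∀ p : P, ∃ R : EB →ₗ[ℝ] EP, ∀ v, orbitProjDeriv EP G EB p (R v) = v := by
    intro p
    have hD : LinearMap.range (orbitProjDeriv EP G EB p).toLinearMap = ⊤ :=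
      LinearMap.range_eq_top.2 (hquot.2 p)
    obtain ⟨R, hR⟩ := LinearMap.exists_rightInverse_of_surjective _ hD
    exact ⟨R, fun v => LinearMap.congr_fun hR v⟩
  choose R hR using hR
  let η' : DForm 𝓘(ℝ, EB) (MulAction.orbitRel.Quotient G P) 2 := fun b =>
    ((η.onModel b.out).compContinuousLinearMap (LinearMap.toContinuousLinearMap (R b.out)) :
      EB [⋀^Fin 2]→L[ℝ] ℝ)
  have hpull : DForm.pullback (orbitProj P G) η' = η := by
    funext p
    set q := (orbitProj P G p).out with hq
    have hqp : orbitProj P G p = orbitProj P G q := (Quotient.out_eq _).symm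
    obtain ⟨g, hg⟩ := exists_smul_eq_of_orbitProj_eq hqp
    have hgd : ∀ (g : G) (q : P), MDifferentiableAt 𝓘(ℝ, EP) 𝓘(ℝ, EP) (fun p : P => g • p) q :=
      fun g q => (ContMDiffSMul.contMDiff_const_smul (I := 𝓘(ℝ, EG)) (n := ∞) g).mdifferentiable
        (by simp) q
    have hdg : ∀ w : EP, orbitProjDeriv EP G EB p
        (modelDeriv 𝓘(ℝ, EP) 𝓘(ℝ, EP) (fun p : P => g • p) q w) = orbitProjDeriv EP G EB q w := by
      intro w
      have h1 := modelDeriv_comp_apply q (hquot.1.mdifferentiable (by simp) p) (hgd g q) hg w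
      have h2 : orbitProj P G ∘ (fun p : P => g • p) = orbitProj P G :=
        funext fun p => orbitProj_smul g p
      rw [h2] at h1
      exact h1.symm
    have hsurj : ∀ v : EP, ∃ w : EP,
        modelDeriv 𝓘(ℝ, EP) 𝓘(ℝ, EP) (fun p : P => g • p) q w = v := by
      intro v
      have h1 := modelDeriv_comp_apply p (hgd g q) (hgd g⁻¹ p) (inv_smul_eq_iff.2 hg.symm) v
      have h2 : (fun p : P => g • p) ∘ (fun p : P => g⁻¹ • p) = id :=
        funext fun p => smul_inv_smul g p
      rw [h2, modelDeriv_id] at h1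
      exact ⟨_, h1.symm⟩
    have hinvq : ∀ w : Fin 2 → EP, η.onModel p
        (fun i => modelDeriv 𝓘(ℝ, EP) 𝓘(ℝ, EP) (fun p : P => g • p) q (w i)) =
        η.onModel q w := by
      intro w
      have h1 : (η.onModel (g • q)).compContinuousLinearMap
          (modelDeriv 𝓘(ℝ, EP) 𝓘(ℝ, EP) (fun p : P => g • p) q) = η.onModel q :=
        congrFun (hinv g) q
      rw [hg] at h1
      exact DFunLike.congr_fun h1 w
    have key : ∀ v : Fin 2 → EP, η.onModel q (fun i => R q (orbitProjDeriv EP G EB p (v i))) =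
        η.onModel p v := by
      intro v
      choose w hw using fun i => hsurj (v i)
      have hv : v = fun i => modelDeriv 𝓘(ℝ, EP) 𝓘(ℝ, EP) (fun p : P => g • p) q (w i) :=
        funext fun i => (hw i).symm
      rw [hv, hinvq]
      refine (η.onModel q).apply_eq_of_sub_mem
        (K := LinearMap.ker (orbitProjDeriv EP G EB q).toLinearMap) ?_ ?_
      · intro κ hκ u
        obtain ⟨ξ, rfl⟩ := exists_orbitDeriv_eq (EG := EG) hquot q κ hκ
        exact hhor ξ q u
      · intro i
        rw [LinearMap.mem_ker, map_sub, sub_eq_zero]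
        exact (hR q _).trans (hdg (w i))
    ext v
    exact key v
  have hloc := DForm.exists_local_pullback_of_pullback_orbitProj hquot hpull
  exact ⟨η', DForm.isSmooth_of_local_pullback hη hloc,
    DForm.isClosed_of_local_pullback hη hηc hloc, hpull⟩

end BasicForms

section FiberProducts

open Filter Topology

variable {EP : Type*} [NormedAddCommGroup EP] [NormedSpace ℝ EP]
  {EQ : Type*} [NormedAddCommGroup EQ] [NormedSpace ℝ EQ]
  {P : Type*} [TopologicalSpace P] [ChartedSpace EP P]
  {Q : Type*} [TopologicalSpace Q] [ChartedSpace EQ Q] [IsManifold 𝓘(ℝ, EQ) ∞ Q]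
  {EX : Type*} [NormedAddCommGroup EX] [NormedSpace ℝ EX]
  {HX : Type*} [TopologicalSpace HX] {IX : ModelWithCorners ℝ EX HX}
  {X : Type*} [TopologicalSpace X] [ChartedSpace HX X]

theorem TPQ.contMDiffAt_iff {ε : C^∞⟮𝓘(ℝ, EP), P; 𝓘(ℝ, EQ), Q⟯} {f : X → TPQ ε} {x : X} :
    ContMDiffAt IX (𝓘(ℝ, EP).prod 𝓘(ℝ, EQ)) ∞ f x ↔
      ContMDiffAt IX 𝓘(ℝ, EP) ∞ (fun y => (f y).proj) x ∧
      ContMDiffAt IX (𝓘(ℝ, EQ).prod 𝓘(ℝ, EQ)) ∞ (fun y => TPQ.tau1 ε (f y)) x := by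
  rw [contMDiffAt_totalSpace, contMDiffAt_totalSpace]
  refine and_congr_right fun h => ?_
  have h2 : ContMDiffAt IX 𝓘(ℝ, EQ) ∞ (fun y => (TPQ.tau1 ε (f y)).proj) x :=
    ε.contMDiff.contMDiffAt.comp x h
  rw [and_iff_right h2]
  exact Iff.rfl

theorem TstarPQ.contMDiffAt_iff {ε : C^∞⟮𝓘(ℝ, EP), P; 𝓘(ℝ, EQ), Q⟯} {f : X → TstarPQ ε}
    {x : X} :
    ContMDiffAt IX (𝓘(ℝ, EP).prod 𝓘(ℝ, EQ →L[ℝ] ℝ)) ∞ f x ↔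
      ContMDiffAt IX 𝓘(ℝ, EP) ∞ (fun y => (f y).proj) x ∧
      ContMDiffAt IX (𝓘(ℝ, EQ).prod 𝓘(ℝ, EQ →L[ℝ] ℝ)) ∞ (fun y => TstarPQ.pi1 ε (f y)) x := by
  rw [contMDiffAt_totalSpace, contMDiffAt_totalSpace]
  refine and_congr_right fun h => ?_
  have h2 : ContMDiffAt IX 𝓘(ℝ, EQ) ∞ (fun y => (TstarPQ.pi1 ε (f y)).proj) x :=
    ε.contMDiff.contMDiffAt.comp x h
  rw [and_iff_right h2]
  exact Iff.rfl

variable (ε : C^∞⟮𝓘(ℝ, EP), P; 𝓘(ℝ, EQ), Q⟯)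

theorem TPQ.contMDiff_proj :
    ContMDiff (𝓘(ℝ, EP).prod 𝓘(ℝ, EQ)) 𝓘(ℝ, EP) ∞ (fun z : TPQ ε => z.proj) :=
  fun _ => (TPQ.contMDiffAt_iff.1 contMDiffAt_id).1

theorem TPQ.contMDiff_tau1 :
    ContMDiff (𝓘(ℝ, EP).prod 𝓘(ℝ, EQ)) (𝓘(ℝ, EQ).prod 𝓘(ℝ, EQ)) ∞ (TPQ.tau1 ε) :=
  fun _ => (TPQ.contMDiffAt_iff.1 contMDiffAt_id).2

theorem TstarPQ.contMDiff_pi1 :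
    ContMDiff (𝓘(ℝ, EP).prod 𝓘(ℝ, EQ →L[ℝ] ℝ)) (𝓘(ℝ, EQ).prod 𝓘(ℝ, EQ →L[ℝ] ℝ)) ∞
      (TstarPQ.pi1 ε) :=
  fun _ => (TstarPQ.contMDiffAt_iff.1 contMDiffAt_id).2

theorem TstarPQ.contMDiff_pi2 :
    ContMDiff (𝓘(ℝ, EP).prod 𝓘(ℝ, EQ →L[ℝ] ℝ)) 𝓘(ℝ, EP) ∞ (TstarPQ.pi2 ε) :=
  fun _ => (TstarPQ.contMDiffAt_iff.1 contMDiffAt_id).1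

/-- The point of `T_P Q` over `p` whose vector is given by an element of the model space. -/
def TPQ.ofModel (p : P) (v : EQ) : TPQ ε := ⟨p, v⟩

theorem TPQ.mk_eq_ofModel (v : TangentBundle 𝓘(ℝ, EQ) Q) (p : P) (h : v.proj = ε p) :
    TPQ.mk ε v p h = TPQ.ofModel ε p v.2 := by
  have key : ∀ (q r : Q) (h : q = r) (v : EQ),
      ((h ▸ (v : TangentSpace 𝓘(ℝ, EQ) q) : TangentSpace 𝓘(ℝ, EQ) r) : EQ) = v := by
    rintro q _ rfl v; rfl
  exact congrArg (TPQ.ofModel ε p) (key _ _ h _)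

theorem TPQ.tau1_ofModel_eq {q : Q} {p : P} (h : ε p = q) (v : EQ) :
    TPQ.tau1 ε (TPQ.ofModel ε p v) = (⟨q, v⟩ : TangentBundle 𝓘(ℝ, EQ) Q) := by
  subst h; rfl

end FiberProducts

section FiberDerivative

open Filter Topology

variable {EP : Type*} [NormedAddCommGroup EP] [NormedSpace ℝ EP]
  {EQ : Type*} [NormedAddCommGroup EQ] [NormedSpace ℝ EQ]
  {P : Type*} [TopologicalSpace P] [ChartedSpace EP P] [IsManifold 𝓘(ℝ, EP) ∞ P]
  {Q : Type*} [TopologicalSpace Q] [ChartedSpace EQ Q] [IsManifold 𝓘(ℝ, EQ) ∞ Q]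

theorem contMDiffAt_fderiv_param {EX : Type*} [NormedAddCommGroup EX] [NormedSpace ℝ EX]
    {HX : Type*} [TopologicalSpace HX] {IX : ModelWithCorners ℝ EX HX}
    {X : Type*} [TopologicalSpace X] [ChartedSpace HX X] [IsManifold IX ∞ X]
    {K : X → EQ → ℝ} {g : X → EQ} {x : X}
    (hK : ContMDiffAt (IX.prod 𝓘(ℝ, EQ)) 𝓘(ℝ, ℝ) ∞ (Function.uncurry K) (x, g x))
    (hg : ContMDiffAt IX 𝓘(ℝ, EQ) ∞ g x) :
    ContMDiffAt IX 𝓘(ℝ, EQ →L[ℝ] ℝ) ∞ (fun y => fderiv ℝ (K y) (g y)) x := by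
  have h := ContMDiffAt.mfderiv K g hK hg (m := ∞) (by simp)
  have he := inTangentCoordinates_model_space (I := 𝓘(ℝ, EQ)) (I' := 𝓘(ℝ, ℝ)) g
    (fun y => K y (g y)) (fun y => modelDeriv 𝓘(ℝ, EQ) 𝓘(ℝ, ℝ) (K y) (g y)) x
  have h' := (congrArg (fun F : X → EQ →L[ℝ] ℝ => ContMDiffAt IX 𝓘(ℝ, EQ →L[ℝ] ℝ) ∞ F x) he).mp h
  refine h'.congr_of_eventuallyEq (Eventually.of_forall fun y => ?_)
  exact mfderiv_eq_fderiv.symm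

namespace MagneticLagrangianSystem

variable (S : MagneticLagrangianSystem EP EQ P Q)

/-- The fiber derivative in the bundle coordinates at `z₀`. -/
def coordFiberDeriv (z₀ z : TPQ S.ε) : EQ →L[ℝ] ℝ :=
  fderiv ℝ (fun w : EQ => S.L ⟨z.proj,
    (trivializationAt EQ (TangentSpace 𝓘(ℝ, EQ)) (S.ε z₀.proj)).symm (S.ε z.proj) w⟩)
    (trivializationAt EQ (TangentSpace 𝓘(ℝ, EQ)) (S.ε z₀.proj) (TPQ.tau1 S.ε z)).2

theorem contMDiffAt_trivialization_tau1 (z₀ : TPQ S.ε) :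
    ContMDiffAt (𝓘(ℝ, EP).prod 𝓘(ℝ, EQ)) 𝓘(ℝ, EQ) ∞ (fun z : TPQ S.ε =>
      (trivializationAt EQ (TangentSpace 𝓘(ℝ, EQ)) (S.ε z₀.proj) (TPQ.tau1 S.ε z)).2) z₀ :=
  (contMDiffAt_totalSpace.1 (TPQ.contMDiff_tau1 S.ε z₀)).2

theorem eventually_mem_baseSet (z₀ : TPQ S.ε) : ∀ᶠ z in 𝓝 z₀, S.ε z.proj ∈
    (trivializationAt EQ (TangentSpace 𝓘(ℝ, EQ) (M := Q)) (S.ε z₀.proj)).baseSet :=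
  (S.ε.contMDiff.continuous.comp (TPQ.contMDiff_proj S.ε).continuous).continuousAt
    ((trivializationAt EQ (TangentSpace 𝓘(ℝ, EQ) (M := Q)) (S.ε z₀.proj)).open_baseSet.mem_nhds
      (mem_baseSet_trivializationAt EQ _ _))

theorem contMDiffAt_coordFiberDeriv (z₀ : TPQ S.ε) :
    ContMDiffAt (𝓘(ℝ, EP).prod 𝓘(ℝ, EQ)) 𝓘(ℝ, EQ →L[ℝ] ℝ) ∞ (S.coordFiberDeriv z₀) z₀ := by
  refine contMDiffAt_fderiv_param ?_ (S.contMDiffAt_trivialization_tau1 z₀)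
  set e := trivializationAt EQ (TangentSpace 𝓘(ℝ, EQ) (M := Q)) (S.ε z₀.proj)
  refine S.smooth_L.contMDiffAt.comp (I' := 𝓘(ℝ, EP).prod 𝓘(ℝ, EQ)) (z₀, (e (TPQ.tau1 S.ε z₀)).2)
    (f := fun x : TPQ S.ε × EQ => (⟨x.1.proj, e.symm (S.ε x.1.proj) x.2⟩ : TPQ S.ε)) ?_
  have hp : ContMDiffAt ((𝓘(ℝ, EP).prod 𝓘(ℝ, EQ)).prod 𝓘(ℝ, EQ)) 𝓘(ℝ, EP) ∞
      (fun x : TPQ S.ε × EQ => x.1.proj) (z₀, (e (TPQ.tau1 S.ε z₀)).2) :=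
    (TPQ.contMDiff_proj S.ε).contMDiffAt.comp _ contMDiffAt_fst
  refine TPQ.contMDiffAt_iff.2 ⟨hp, ?_⟩
  have hpair : ContMDiffAt ((𝓘(ℝ, EP).prod 𝓘(ℝ, EQ)).prod 𝓘(ℝ, EQ))
      (𝓘(ℝ, EQ).prod 𝓘(ℝ, EQ)) ∞ (fun x : TPQ S.ε × EQ => (S.ε x.1.proj, x.2))
      (z₀, (e (TPQ.tau1 S.ε z₀)).2) :=
    (S.ε.contMDiff.contMDiffAt.comp _ hp).prodMk contMDiffAt_snd
  have hmem : (S.ε z₀.proj, (e (TPQ.tau1 S.ε z₀)).2) ∈ e.target :=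
    e.mem_target.2 (mem_baseSet_trivializationAt EQ _ _)
  have hsymm : ContMDiffAt (𝓘(ℝ, EQ).prod 𝓘(ℝ, EQ)) (𝓘(ℝ, EQ).prod 𝓘(ℝ, EQ)) ∞
      e.toOpenPartialHomeomorph.symm (S.ε z₀.proj, (e (TPQ.tau1 S.ε z₀)).2) :=
    (e.contMDiffOn_symm (IB := 𝓘(ℝ, EQ)) (n := ∞)).contMDiffAt (e.open_target.mem_nhds hmem)
  refine (ContMDiffAt.comp (z₀, (e (TPQ.tau1 S.ε z₀)).2) (g := e.toOpenPartialHomeomorph.symm)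
    (f := fun x : TPQ S.ε × EQ => (S.ε x.1.proj, x.2)) hsymm hpair).congr_of_eventuallyEq ?_
  have hev : ∀ᶠ x : TPQ S.ε × EQ in 𝓝 (z₀, (e (TPQ.tau1 S.ε z₀)).2),
      S.ε x.1.proj ∈ e.baseSet :=
    (continuous_fst.tendsto (z₀, (e (TPQ.tau1 S.ε z₀)).2)).eventually (S.eventually_mem_baseSet z₀)
  filter_upwards [hev] with x hx
  exact e.mk_symm hx x.2

theorem coordFiberDeriv_apply {z₀ z : TPQ S.ε} (hz : S.ε z.proj ∈
    (trivializationAt EQ (TangentSpace 𝓘(ℝ, EQ) (M := Q)) (S.ε z₀.proj)).baseSet) (w : EQ) :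
    S.coordFiberDeriv z₀ z w = S.fiberCovector z
      ((trivializationAt EQ (TangentSpace 𝓘(ℝ, EQ)) (S.ε z₀.proj)).symm (S.ε z.proj) w) := by
  set e := trivializationAt EQ (TangentSpace 𝓘(ℝ, EQ) (M := Q)) (S.ε z₀.proj) with he
  let A : EQ ≃L[ℝ] EQ := (e.continuousLinearEquivAt ℝ (S.ε z.proj) hz).symm
  have hA : ∀ w, A w = e.symm (S.ε z.proj) w := fun w => rfl
  let f : EQ → ℝ := fun w => S.L (TPQ.ofModel S.ε z.proj w)
  have h1 : S.coordFiberDeriv z₀ z = fderiv ℝ (f ∘ A) (e (TPQ.tau1 S.ε z)).2 := rfl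
  have h2 : A (e (TPQ.tau1 S.ε z)).2 = (z.2 : EQ) :=
    (e.continuousLinearEquivAt ℝ (S.ε z.proj) hz).symm_apply_apply z.2
  rw [h1, A.comp_right_fderiv, h2]
  rfl

theorem contMDiff_fiberDeriv : ContMDiff (𝓘(ℝ, EP).prod 𝓘(ℝ, EQ))
    (𝓘(ℝ, EP).prod 𝓘(ℝ, EQ →L[ℝ] ℝ)) ∞ S.fiberDeriv := by
  intro z₀
  refine TstarPQ.contMDiffAt_iff.2 ⟨TPQ.contMDiff_proj S.ε z₀, ?_⟩
  refine (contMDiffAt_hom_bundle _).2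
    ⟨S.ε.contMDiff.contMDiffAt.comp z₀ (TPQ.contMDiff_proj S.ε z₀), ?_⟩
  refine (S.contMDiffAt_coordFiberDeriv z₀).congr_of_eventuallyEq ?_
  filter_upwards [S.eventually_mem_baseSet z₀] with z hz
  ext w
  rw [S.coordFiberDeriv_apply hz]
  have h1 := (trivializationAt EQ (TangentSpace 𝓘(ℝ, EQ) (M := Q)) (S.ε z₀.proj)).symmL_apply
    (R := ℝ) hz w
  simp [ContinuousLinearMap.inCoordinates]
  exact congrArg (S.fiberCovector z) h1

theorem contMDiff_energy :
    ContMDiff (𝓘(ℝ, EP).prod 𝓘(ℝ, EQ)) 𝓘(ℝ, ℝ) ∞ S.energy := by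
  intro z₀
  have h1 := (S.contMDiffAt_coordFiberDeriv z₀).clm_apply (S.contMDiffAt_trivialization_tau1 z₀)
  refine (h1.sub (S.smooth_L z₀)).congr_of_eventuallyEq ?_
  filter_upwards [S.eventually_mem_baseSet z₀] with z hz
  have h2 := S.coordFiberDeriv_apply hz
    (trivializationAt EQ (TangentSpace 𝓘(ℝ, EQ)) (S.ε z₀.proj) (TPQ.tau1 S.ε z)).2
  have h3 : (trivializationAt EQ (TangentSpace 𝓘(ℝ, EQ)) (S.ε z₀.proj)).symm (S.ε z.proj)
      (trivializationAt EQ (TangentSpace 𝓘(ℝ, EQ)) (S.ε z₀.proj) (TPQ.tau1 S.ε z)).2 = z.2 :=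
    ((trivializationAt EQ (TangentSpace 𝓘(ℝ, EQ) (M := Q)) (S.ε z₀.proj)).continuousLinearEquivAt
      ℝ (S.ε z.proj) hz).symm_apply_apply z.2
  rw [h3] at h2
  exact congrArg (· - S.L z) h2.symm

/-- The curve in `T_P Q` induced by a smooth curve is smooth. -/
theorem contMDiffAt_inducedCurve {c : ℝ → P} {J : Set ℝ} (hJ : IsOpen J)
    (hc : ContMDiffOn 𝓘(ℝ, ℝ) 𝓘(ℝ, EP) ∞ c J) {t : ℝ} (ht : t ∈ J) :
    ContMDiffAt 𝓘(ℝ, ℝ) (𝓘(ℝ, EP).prod 𝓘(ℝ, EQ)) ∞ (S.inducedCurve c) t := by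
  refine TPQ.contMDiffAt_iff.2 ⟨hc.contMDiffAt (hJ.mem_nhds ht), ?_⟩
  have hq : ContMDiffOn 𝓘(ℝ, ℝ) 𝓘(ℝ, EQ) ∞ (fun s => S.ε (c s)) J :=
    S.ε.contMDiff.comp_contMDiffOn hc
  have h1 := hq.contMDiffOn_tangentMapWithin (m := ∞) (by simp) hJ.uniqueMDiffOn
  have h2 : ContMDiff 𝓘(ℝ, ℝ) 𝓘(ℝ, ℝ).tangent ∞
      (fun s : ℝ => (⟨s, (1 : ℝ)⟩ : TangentBundle 𝓘(ℝ, ℝ) ℝ)) := by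
    intro s
    rw [contMDiffAt_totalSpace]
    exact ⟨contMDiffAt_id, by simpa using contMDiffAt_const⟩
  have h3 := (h1.comp h2.contMDiffOn (fun s hs => hs)).contMDiffAt (hJ.mem_nhds ht)
  refine h3.congr_of_eventuallyEq ?_
  filter_upwards [hJ.mem_nhds ht] with s hs
  have : mfderivWithin 𝓘(ℝ, ℝ) 𝓘(ℝ, EQ) (fun s => S.ε (c s)) J s =
    mfderiv 𝓘(ℝ, ℝ) 𝓘(ℝ, EQ) (fun s => S.ε (c s)) s := mfderivWithin_of_isOpen hJ hs
  simp only [Function.comp_apply, tangentMapWithin, this]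
  rfl

end MagneticLagrangianSystem

end FiberDerivative

section PullbackComp

variable {E : Type*} [NormedAddCommGroup E] [NormedSpace ℝ E]
  {H : Type*} [TopologicalSpace H] {I : ModelWithCorners ℝ E H}
  {M : Type*} [TopologicalSpace M] [ChartedSpace H M]
  {E' : Type*} [NormedAddCommGroup E'] [NormedSpace ℝ E']
  {H' : Type*} [TopologicalSpace H'] {I' : ModelWithCorners ℝ E' H'}
  {M' : Type*} [TopologicalSpace M'] [ChartedSpace H' M']
  {E'' : Type*} [NormedAddCommGroup E''] [NormedSpace ℝ E'']
  {H'' : Type*} [TopologicalSpace H''] {I'' : ModelWithCorners ℝ E'' H''}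
  {M'' : Type*} [TopologicalSpace M''] [ChartedSpace H'' M''] {k : ℕ}

theorem DForm.pullback_comp {f : M → M'} {g : M' → M''} (hg : MDifferentiable I' I'' g)
    (hf : MDifferentiable I I' f) (η : DForm I'' M'' k) :
    DForm.pullback (I := I) (g ∘ f) η = DForm.pullback f (DForm.pullback (I := I') g η) := by
  funext x
  ext v
  refine congrArg (η (g (f x))) (funext fun i => ?_)
  exact mfderiv_comp_apply x (hg (f x)) (hf x) (v i)

theorem DForm.pullback_add (f : M → M') (η₁ η₂ : DForm I' M' k) :
    DForm.pullback (I := I) f (fun x => η₁ x + η₂ x) =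
      fun x => DForm.pullback f η₁ x + DForm.pullback f η₂ x := by
  funext x; ext v; rfl

end PullbackComp

section Reduction

open Filter Topology

variable {EP : Type*} [NormedAddCommGroup EP] [NormedSpace ℝ EP]
  {EQ : Type*} [NormedAddCommGroup EQ] [NormedSpace ℝ EQ]
  {P : Type*} [TopologicalSpace P] [ChartedSpace EP P] [IsManifold 𝓘(ℝ, EP) ∞ P]
  {Q : Type*} [TopologicalSpace Q] [ChartedSpace EQ Q] [IsManifold 𝓘(ℝ, EQ) ∞ Q]
  {EG : Type*} [NormedAddCommGroup EG] [NormedSpace ℝ EG]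
  {G : Type*} [Group G] [TopologicalSpace G] [ChartedSpace EG G] [MulAction G P]
  {EB : Type*} [NormedAddCommGroup EB] [NormedSpace ℝ EB]
  [ChartedSpace EB (MulAction.orbitRel.Quotient G P)]
  [IsManifold 𝓘(ℝ, EB) ∞ (MulAction.orbitRel.Quotient G P)]

section TauG

variable {ε : C^∞⟮𝓘(ℝ, EP), P; 𝓘(ℝ, EQ), Q⟯}
  {ε' : C^∞⟮𝓘(ℝ, EB), MulAction.orbitRel.Quotient G P; 𝓘(ℝ, EQ), Q⟯}

theorem tauG_eq_ofModel (h : ∀ p : P, ε' (orbitProj P G p) = ε p) (z : TPQ ε) :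
    tauG G h z = TPQ.ofModel ε' (orbitProj P G z.proj) z.2 :=
  TPQ.mk_eq_ofModel ε' _ _ _

theorem tau1_tauG (h : ∀ p : P, ε' (orbitProj P G p) = ε p) (z : TPQ ε) :
    TPQ.tau1 ε' (tauG G h z) = TPQ.tau1 ε z := by
  rw [tauG_eq_ofModel]
  exact TPQ.tau1_ofModel_eq ε' (h z.proj) z.2

theorem tauG_surjective (h : ∀ p : P, ε' (orbitProj P G p) = ε p) :
    Function.Surjective (tauG G h) := by
  rintro ⟨b, v⟩
  obtain ⟨p, rfl⟩ := orbitProj_surjective b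
  exact ⟨TPQ.ofModel ε p v, tauG_eq_ofModel h _⟩

theorem contMDiff_tauG (hπ : ContMDiff 𝓘(ℝ, EP) 𝓘(ℝ, EB) ∞ (orbitProj P G))
    (h : ∀ p : P, ε' (orbitProj P G p) = ε p) :
    ContMDiff (𝓘(ℝ, EP).prod 𝓘(ℝ, EQ)) (𝓘(ℝ, EB).prod 𝓘(ℝ, EQ)) ∞ (tauG G h) := by
  intro z
  refine TPQ.contMDiffAt_iff.2 ⟨hπ.contMDiffAt.comp z (TPQ.contMDiff_proj ε z), ?_⟩
  refine (TPQ.contMDiff_tau1 ε z).congr_of_eventuallyEq (Eventually.of_forall fun y => ?_)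
  exact tau1_tauG h y

end TauG

namespace MagneticLagrangianSystem

variable {S : MagneticLagrangianSystem EP EQ P Q}
  {S' : MagneticLagrangianSystem EB EQ (MulAction.orbitRel.Quotient G P) Q}

theorem fiberCovector_eq_fderiv (z : TPQ S.ε) :
    (S.fiberCovector z : EQ →L[ℝ] ℝ) =
      fderiv ℝ (fun w : EQ => S.L (TPQ.ofModel S.ε z.proj w)) z.2 := rfl

theorem fiberCovector_tauG (hS' : IsReducedSystem G S S') (z : TPQ S.ε) :
    (S'.fiberCovector (tauG G hS'.eps z) : EQ →L[ℝ] ℝ) = S.fiberCovector z := by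
  rw [tauG_eq_ofModel, fiberCovector_eq_fderiv, fiberCovector_eq_fderiv]
  have h : (fun w : EQ => S'.L (TPQ.ofModel S'.ε (orbitProj P G z.proj) w)) =
      fun w : EQ => S.L (TPQ.ofModel S.ε z.proj w) := by
    funext w
    rw [← hS'.lagrangian, tauG_eq_ofModel]
    rfl
  exact congrArg (fun f : EQ → ℝ => fderiv ℝ f z.2) h

/-- The energy of the reduced system pulls back to the energy of the original system. -/
theorem energy_tauG (hS' : IsReducedSystem G S S') (z : TPQ S.ε) :
    S'.energy (tauG G hS'.eps z) = S.energy z := by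
  have h2 : ((tauG G hS'.eps z).2 : EQ) = z.2 := by rw [tauG_eq_ofModel]; rfl
  have h1 : (S'.fiberCovector (tauG G hS'.eps z) : EQ →L[ℝ] ℝ) (tauG G hS'.eps z).2 =
      (S.fiberCovector z : EQ →L[ℝ] ℝ) z.2 :=
    congrArg₂ (fun (f : EQ →L[ℝ] ℝ) (v : EQ) => f v) (fiberCovector_tauG hS' z) h2
  exact congrArg₂ (fun a b : ℝ => a - b) h1 (hS'.lagrangian z)

theorem pi1_fiberDeriv_tauG (hS' : IsReducedSystem G S S') (z : TPQ S.ε) :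
    TstarPQ.pi1 S'.ε (S'.fiberDeriv (tauG G hS'.eps z)) = TstarPQ.pi1 S.ε (S.fiberDeriv z) := by
  have key : ∀ (q r : Q) (h : q = r) (α β : EQ →L[ℝ] ℝ), α = β →
      (⟨q, α⟩ : CotBundle EQ Q) = ⟨r, β⟩ := by
    rintro q _ rfl α _ rfl; rfl
  exact key _ _ (hS'.eps z.proj) _ _ (fiberCovector_tauG hS' z)

theorem Omega_eq (S : MagneticLagrangianSystem EP EQ P Q) :
    S.Omega = fun z => DForm.pullback (TstarPQ.pi1 S.ε ∘ S.fiberDeriv) (canonicalTwoForm EQ Q) z +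
      DForm.pullback (I' := 𝓘(ℝ, EP)) (fun z : TPQ S.ε => z.proj) S.B z := by
  have h1 := DForm.pullback_comp ((TstarPQ.contMDiff_pi1 S.ε).mdifferentiable (by simp))
    (S.contMDiff_fiberDeriv.mdifferentiable (by simp)) (canonicalTwoForm EQ Q)
  have h2 := DForm.pullback_comp ((TstarPQ.contMDiff_pi2 S.ε).mdifferentiable (by simp))
    (S.contMDiff_fiberDeriv.mdifferentiable (by simp)) S.B
  have h3 : (TstarPQ.pi2 S.ε ∘ S.fiberDeriv) = fun z : TPQ S.ε => z.proj := rfl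
  rw [← h3, h1, h2]
  exact DForm.pullback_add S.fiberDeriv _ _

/-- The 2-form of the reduced system pulls back to the 2-form of the original system. -/
theorem pullback_tauG_Omega (hπ : ContMDiff 𝓘(ℝ, EP) 𝓘(ℝ, EB) ∞ (orbitProj P G))
    (hS' : IsReducedSystem G S S') :
    DForm.pullback (tauG G hS'.eps) S'.Omega = S.Omega := by
  have hτ := (contMDiff_tauG hπ hS'.eps).mdifferentiable (by simp)
  have h1 := DForm.pullback_comp
    (((TstarPQ.contMDiff_pi1 S'.ε).comp S'.contMDiff_fiberDeriv).mdifferentiable (by simp))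
    hτ (canonicalTwoForm EQ Q)
  have h2 := DForm.pullback_comp ((TPQ.contMDiff_proj S'.ε).mdifferentiable (by simp)) hτ S'.B
  have h3 := DForm.pullback_comp (hπ.mdifferentiable (by simp))
    ((TPQ.contMDiff_proj S.ε).mdifferentiable (by simp)) S'.B
  have e1 : (TstarPQ.pi1 S'.ε ∘ S'.fiberDeriv) ∘ tauG G hS'.eps =
      TstarPQ.pi1 S.ε ∘ S.fiberDeriv := funext fun z => pi1_fiberDeriv_tauG hS' z
  have e2 : (fun z : TPQ S'.ε => z.proj) ∘ tauG G hS'.eps =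
      orbitProj P G ∘ (fun z : TPQ S.ε => z.proj) := rfl
  rw [hS'.magnetic] at h3
  rw [S.Omega_eq, S'.Omega_eq, DForm.pullback_add, ← h1, ← h2, e1, e2, h3]

/-- Every smooth lift of a solution of the reduced system is a solution. -/
theorem IsELSolution.of_lift (hπ : ContMDiff 𝓘(ℝ, EP) 𝓘(ℝ, EB) ∞ (orbitProj P G))
    (hS' : IsReducedSystem G S S') {J : Set ℝ} (hJ : IsOpen J)
    {c' : ℝ → MulAction.orbitRel.Quotient G P} (hc' : S'.IsELSolution J c')
    {c : ℝ → P} (hc : ContMDiffOn 𝓘(ℝ, ℝ) 𝓘(ℝ, EP) ∞ c J)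
    (hcc' : ∀ t ∈ J, orbitProj P G (c t) = c' t) : S.IsELSolution J c := by
  refine ⟨hc, fun t ht w => ?_⟩
  have hcurve : ∀ s ∈ J, tauG G hS'.eps (S.inducedCurve c s) = S'.inducedCurve c' s := by
    intro s hs
    have h1 : (fun u => S.ε (c u)) =ᶠ[𝓝 s] fun u => S'.ε (c' u) := by
      filter_upwards [hJ.mem_nhds hs] with u hu
      rw [← hcc' u hu, hS'.eps]
    have h2 := h1.modelDeriv_eq (I := 𝓘(ℝ, ℝ)) (I' := 𝓘(ℝ, EQ))
    rw [tauG_eq_ofModel]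
    exact congrArg₂ (TPQ.ofModel S'.ε) (hcc' s hs) (DFunLike.congr_fun h2 (1 : ℝ))
  have hτ := (contMDiff_tauG hπ hS'.eps).mdifferentiable (by simp) (S.inducedCurve c t)
  have hγ := (S.contMDiffAt_inducedCurve hJ hc ht).mdifferentiableAt (by simp)
  have hev : tauG G hS'.eps ∘ S.inducedCurve c =ᶠ[𝓝 t] S'.inducedCurve c' := by
    filter_upwards [hJ.mem_nhds ht] with s hs using hcurve s hs
  have hd := modelDeriv_comp_apply t hτ hγ rfl (1 : ℝ)
  rw [hev.modelDeriv_eq] at hd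
  have hEL : ∀ u : EB × EQ, S'.Omega.onModel (tauG G hS'.eps (S.inducedCurve c t))
      ![modelDeriv 𝓘(ℝ, ℝ) (𝓘(ℝ, EB).prod 𝓘(ℝ, EQ)) (S'.inducedCurve c') t 1, u] =
      - modelDeriv (𝓘(ℝ, EB).prod 𝓘(ℝ, EQ)) 𝓘(ℝ, ℝ) S'.energy (tauG G hS'.eps (S.inducedCurve c t)) u := by
    rw [hcurve t ht]
    exact hc'.2 t ht
  have hE := modelDeriv_comp_apply (I'' := 𝓘(ℝ, ℝ)) (S.inducedCurve c t)
    (S'.contMDiff_energy.mdifferentiable (by simp) _) hτ rfl w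
  have hE' : S'.energy ∘ tauG G hS'.eps = S.energy := funext fun z => energy_tauG hS' z
  rw [hE'] at hE
  have hΩ : S.Omega.onModel (S.inducedCurve c t) =
      (S'.Omega.onModel (tauG G hS'.eps (S.inducedCurve c t))).compContinuousLinearMap
        (modelDeriv (𝓘(ℝ, EP).prod 𝓘(ℝ, EQ)) (𝓘(ℝ, EB).prod 𝓘(ℝ, EQ)) (tauG G hS'.eps) (S.inducedCurve c t)) :=
    (congrFun (pullback_tauG_Omega hπ hS') (S.inducedCurve c t)).symm
  have hfin : S.Omega.onModel (S.inducedCurve c t)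
      ![modelDeriv 𝓘(ℝ, ℝ) (𝓘(ℝ, EP).prod 𝓘(ℝ, EQ)) (S.inducedCurve c) t 1, w] =
      - modelDeriv (𝓘(ℝ, EP).prod 𝓘(ℝ, EQ)) 𝓘(ℝ, ℝ) S.energy (S.inducedCurve c t) w := by
    rw [hE, ← hEL, hd, hΩ]
    refine congrArg (S'.Omega.onModel _) (funext fun i => ?_)
    fin_cases i <;> rfl
  exact hfin

theorem FiberwiseReducible.L_smul (hS : S.FiberwiseReducible EG G) (g : G) (p : P) (v : EQ) :
    S.L (TPQ.ofModel S.ε (g • p) v) = S.L (TPQ.ofModel S.ε p v) := by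
  have h := hS.invariant_L g (TPQ.ofModel S.ε p v)
  exact (congrArg S.L (TPQ.mk_eq_ofModel S.ε _ _ _)).symm.trans h

/-- A reduced system is determined by the original system. -/
theorem eq_of_isReducedSystem (hquot : IsSmoothSubmersion 𝓘(ℝ, EP) 𝓘(ℝ, EB) (orbitProj P G))
    {S₁ S₂ : MagneticLagrangianSystem EB EQ (MulAction.orbitRel.Quotient G P) Q}
    (h₁ : IsReducedSystem G S S₁) (h₂ : IsReducedSystem G S S₂) : S₁ = S₂ := by
  have hε : S₁.ε = S₂.ε := by
    ext b
    obtain ⟨p, rfl⟩ := orbitProj_surjective b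
    rw [h₁.eps, h₂.eps]
  have hB : S₁.B = S₂.B :=
    DForm.pullback_orbitProj_injective hquot (h₁.magnetic.trans h₂.magnetic.symm)
  obtain ⟨e₁, L₁, M₁⟩ := h₁
  obtain ⟨e₂, L₂, M₂⟩ := h₂
  obtain ⟨ε₁, _, _, L₁', _, B₁, _, _⟩ := S₁
  obtain ⟨ε₂, _, _, L₂', _, B₂, _, _⟩ := S₂
  dsimp only at hε hB
  subst hε hB
  have hL : L₁' = L₂' := by
    funext z
    obtain ⟨y, rfl⟩ := tauG_surjective e₁ z
    exact (L₁ y).trans (L₂ y).symm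
  subst hL
  rfl

/-- The reduced system of a fiberwise reducible magnetic Lagrangian system exists. -/
theorem FiberwiseReducible.exists_isReducedSystem
    [FiniteDimensional ℝ EP] [FiniteDimensional ℝ EG] [FiniteDimensional ℝ EB]
    [SecondCountableTopology P] [SecondCountableTopology G] [LieGroup 𝓘(ℝ, EG) ∞ G]
    [ContMDiffSMul 𝓘(ℝ, EG) 𝓘(ℝ, EP) ∞ G P] [IsCancelSMul G P]
    (hquot : IsSmoothSubmersion 𝓘(ℝ, EP) 𝓘(ℝ, EB) (orbitProj P G))
    (hS : S.FiberwiseReducible EG G) :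
    ∃ S' : MagneticLagrangianSystem EB EQ (MulAction.orbitRel.Quotient G P) Q,
      IsReducedSystem G S S' := by
  let e : MulAction.orbitRel.Quotient G P → Q := fun b => S.ε b.out
  have he : ∀ p, e (orbitProj P G p) = S.ε p := by
    intro p
    obtain ⟨g, hg⟩ := exists_smul_eq_of_orbitProj_eq (Quotient.out_eq (orbitProj P G p))
    have := hS.tangent g p
    rwa [hg] at this
  have hes : ContMDiff 𝓘(ℝ, EB) 𝓘(ℝ, EQ) ∞ e := by
    intro b
    obtain ⟨p, rfl⟩ := orbitProj_surjective b
    obtain ⟨σ, -, hσ⟩ := exists_localSection_orbitProj hquot p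
    refine (S.ε.contMDiff.contMDiffAt.comp _ hσ.self_of_nhds.2).congr_of_eventuallyEq ?_
    filter_upwards [hσ] with b hb
    rw [Function.comp_apply, ← he, hb.1]
  let ε' : C^∞⟮𝓘(ℝ, EB), MulAction.orbitRel.Quotient G P; 𝓘(ℝ, EQ), Q⟯ := ⟨e, hes⟩
  have hε' : ∀ p, ε' (orbitProj P G p) = S.ε p := he
  let L' : TPQ ε' → ℝ := fun z => S.L (TPQ.ofModel S.ε z.proj.out z.2)
  have hL : ∀ (p : P) (v : EQ),
      L' (TPQ.ofModel ε' (orbitProj P G p) v) = S.L (TPQ.ofModel S.ε p v) := by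
    intro p v
    obtain ⟨g, hg⟩ := exists_smul_eq_of_orbitProj_eq (Quotient.out_eq (orbitProj P G p))
    have := hS.L_smul g p v
    rwa [hg] at this
  have hLs : ContMDiff (𝓘(ℝ, EB).prod 𝓘(ℝ, EQ)) 𝓘(ℝ, ℝ) ∞ L' := by
    intro z
    obtain ⟨p, hp⟩ := orbitProj_surjective z.proj
    obtain ⟨σ, -, hσ⟩ := exists_localSection_orbitProj hquot p
    rw [hp] at hσ
    have hproj := TPQ.contMDiff_proj ε' z
    have hσz := hproj.continuousAt.eventually hσ
    have hs : ContMDiffAt (𝓘(ℝ, EB).prod 𝓘(ℝ, EQ)) (𝓘(ℝ, EP).prod 𝓘(ℝ, EQ)) ∞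
        (fun y : TPQ ε' => TPQ.ofModel S.ε (σ y.proj) y.2) z := by
      refine TPQ.contMDiffAt_iff.2 ⟨hσ.self_of_nhds.2.comp z hproj, ?_⟩
      refine (TPQ.contMDiff_tau1 ε' z).congr_of_eventuallyEq ?_
      filter_upwards [hσz] with y hy
      exact TPQ.tau1_ofModel_eq S.ε (by rw [← hε', hy.1]) y.2
    refine (S.smooth_L.contMDiffAt.comp z hs).congr_of_eventuallyEq ?_
    filter_upwards [hσz] with y hy
    have h := hL (σ y.proj) y.2
    rw [hy.1] at h
    exact h
  obtain ⟨B', hB's, hB'c, hB'⟩ := DForm.exists_descended (EG := EG) hquot S.smooth_B S.closed_B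
    hS.invariant_B (fun ξ p w => by
      have h := hS.horizontal_B ξ p w
      rw [← infinitesimalGenerator_eq]
      exact h)
  refine ⟨⟨ε', ?_, ⟨hes, ?_⟩, L', hLs, B', hB's, hB'c⟩, ⟨hε', ?_, hB'⟩⟩
  · intro q
    obtain ⟨p, rfl⟩ := S.surjective q
    exact ⟨_, hε' p⟩
  · intro b v
    obtain ⟨p, rfl⟩ := orbitProj_surjective b
    have hd := fun w => modelDeriv_comp_apply (I := 𝓘(ℝ, EP)) (I' := 𝓘(ℝ, EB)) (I'' := 𝓘(ℝ, EQ))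
      p (hes.mdifferentiable (by simp) (orbitProj P G p))
      (hquot.1.mdifferentiable (by simp) p) rfl w
    have hcomp : e ∘ orbitProj P G = S.ε := funext he
    rw [hcomp] at hd
    obtain ⟨w, hw⟩ := S.submersion.2 p v
    exact ⟨modelDeriv 𝓘(ℝ, EP) 𝓘(ℝ, EB) (orbitProj P G) p w, (hd w).symm.trans hw⟩
  · intro z
    rw [tauG_eq_ofModel]
    exact hL z.proj z.2

end MagneticLagrangianSystem

end Reduction

end

theorem mainTheorem6
    {EQ : Type*} [NormedAddCommGroup EQ] [NormedSpace ℝ EQ] [FiniteDimensional ℝ EQ]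
    {Q : Type*} [TopologicalSpace Q] [T2Space Q] [SecondCountableTopology Q]
    [ChartedSpace EQ Q] [IsManifold 𝓘(ℝ, EQ) ∞ Q]
    {EP : Type*} [NormedAddCommGroup EP] [NormedSpace ℝ EP] [FiniteDimensional ℝ EP]
    {P : Type*} [TopologicalSpace P] [T2Space P] [SecondCountableTopology P]
    [ChartedSpace EP P] [IsManifold 𝓘(ℝ, EP) ∞ P]
    {EG : Type*} [NormedAddCommGroup EG] [NormedSpace ℝ EG] [FiniteDimensional ℝ EG]
    {G : Type*} [Group G] [TopologicalSpace G] [T2Space G] [SecondCountableTopology G]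
    [ChartedSpace EG G] [LieGroup 𝓘(ℝ, EG) ∞ G]
    -- a smooth, free and proper action of `G` on `P`
    [MulAction G P] [ContMDiffSMul 𝓘(ℝ, EG) 𝓘(ℝ, EP) ∞ G P] [IsCancelSMul G P] [ProperSMul G P]
    -- the quotient manifold: the orbit space with the smooth structure for which `P → P/G` is a
    -- submersion
    {EB : Type*} [NormedAddCommGroup EB] [NormedSpace ℝ EB] [FiniteDimensional ℝ EB]
    [ChartedSpace EB (MulAction.orbitRel.Quotient G P)]
    [IsManifold 𝓘(ℝ, EB) ∞ (MulAction.orbitRel.Quotient G P)]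
    (hquot : IsSmoothSubmersion 𝓘(ℝ, EP) 𝓘(ℝ, EB) (orbitProj P G))
    (S : MagneticLagrangianSystem EP EQ P Q) (hS : S.FiberwiseReducible EG G) :
    (∃! S' : MagneticLagrangianSystem EB EQ (MulAction.orbitRel.Quotient G P) Q,
      IsReducedSystem G S S') ∧
    ∀ (S' : MagneticLagrangianSystem EB EQ (MulAction.orbitRel.Quotient G P) Q)
      (hS' : IsReducedSystem G S S'),
      DForm.pullback (tauG G hS'.eps) S'.Omega = S.Omega ∧
      (∀ z : TPQ S.ε, S'.energy (tauG G hS'.eps z) = S.energy z) ∧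
      ∀ J : Set ℝ, IsOpen J → J.OrdConnected →
        ∀ c' : ℝ → MulAction.orbitRel.Quotient G P, S'.IsELSolution J c' →
          ∃ c : ℝ → P, S.IsELSolution J c ∧ ∀ t ∈ J, orbitProj P G (c t) = c' t := by
  refine ⟨?_, fun S' hS' => ⟨MagneticLagrangianSystem.pullback_tauG_Omega hquot.1 hS',
    MagneticLagrangianSystem.energy_tauG hS', fun J hJ hJc c' hc' => ?_⟩⟩
  · obtain ⟨S', hS'⟩ := hS.exists_isReducedSystem hquot
    exact ⟨S', hS', fun S'' hS'' => MagneticLagrangianSystem.eq_of_isReducedSystem hquot hS'' hS'⟩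
  · obtain ⟨c, hc⟩ := exists_smooth_lift (EG := EG) hquot hJ hJc hc'.1
    have hcc' : ∀ t ∈ J, orbitProj P G (c t) = c' t := fun t ht => (hc t ht).self_of_nhds.2
    exact ⟨c, hc'.of_lift hquot.1 hS' hJ
      (fun t ht => (hc t ht).self_of_nhds.1.contMDiffWithinAt) hcc', hcc'⟩
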